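/- **Instances.** An instance $(A,I,P_1,\dots,P_\ell,\alpha,k,p)$ consists of $n$ agents $A$, $m$ items $I$, and $\ell$ layers; in layer $j$ every agent $a$ has a preference list $<_a^{(j)}$, a linear order on a subset of $I$ (the items acceptable to $a$ in layer $j$), with an additional empty item $b_\emptyset$ below all acceptable items; moreover integers $1\le\alpha\le\ell$ and $1\le k\le n$, and an assignment $p:A\to I\cup\{b_\emptyset\}$ such that no item of $I$ is assigned to two agents and $p(a)$ is either $b_\emptyset$ or acceptable to $a$ in every layer. A set $K\subseteq A$ *admits a trading cycle* in layer $j$ if its members can be arranged, each exactly once, as $a_0,\dots,a_{r-1}$ ($r\ge1$) with $p(a_i)\in I$ and $p(a_i)<^{(j)}_{a_i}p(a_{i+1 \bmod r})$ for all $i$. An agent $a$ *admits a self loop* in layer $j$ if $p(a)<^{(j)}_a b$ for some item $b\in I$ that $p$ allocates to no agent. The assignment $p$ is - *$(k,\alpha)$-optimal* if: when $k\ge2$, for every $K\subseteq A$ with $|K|=k$ there are $\alpha$ distinct layers in which $K$ admits no trading cycle; and when $k=1$, for every $a\in A$ there are $\alpha$ distinct layers in which $a$ admits no self loop; - *$(k,\alpha)$-upper-bounded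 optimal* if for every $K\subseteq A$ with $|K|\le k$ there are $\alpha$ distinct layers in which $K$ admits no trading cycle, and for every $a\in A$ there are $\alpha$ distinct layers in which $a$ admits no self loop; - *$(k,\alpha)$-subset optimal* if for every $K\subseteq A$ with $|K|=k$ there are $\alpha$ distinct layers in each of which no $K'$ with $K\subseteq K'\subseteq A$ admits a trading cycle; and when $k=1$, for every $a\in A$ there are $\alpha$ distinct layers in which $a$ admits no self loop. Verify-OA, Verify-UOA and Verify-SOA ask, given such an instance, whether $p$ is $(k,\alpha)$-optimal, $(k,\alpha)$-upper-bounded optimal and $(k,\alpha)$-subset optimal, respectively. **Hardness.** A *parameterized reduction* from a parameterized problem $\Pi$ to a parameterized problem $\Pi'$ is an algorithm that, given an instance of $\Pi$ with encoding $x$ and parameter $\kappa$, outputs within $f(\kappa)\cdot(|x|+1)^{c}$ steps an instance of $\Pi'$ with the same yes/no answer and with parameter at most $g(\kappa)$, where $f,g:\mathbb N\to\mathbb N$ are computable and $c$ is a constant. $\mathsf{W[1]}$ is the class of parameterized problems that have a parameterized reduction to Clique parameterized by the solution size, $\mathsf{coW[1]}$ is the class of the complements of problems in $\mathsf{W[1]}$,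 and a problem is *$\mathsf{coW[1]}$-hard* if every problem in $\mathsf{coW[1]}$ has a parameterized reduction to it. **Theorem.** Verify-OA, Verify-UOA and Verify-SOA, each parameterized by $k+\ell$, are $\mathsf{coW[1]}$-hard. -/

import Mathlib

namespace ParamCx

/-! ### Machine model

A random access machine with finitely many arrays of registers, every register holding a natural
number, with addition and (truncated) subtraction as its only arithmetic, and uniform cost. -/

/-- Memory: `M a i` is the content of cell `i` of array `a`.  A program mentions only finitely many
arrays. -/
abbrev Mem : Type := ℕ → ℕ → ℕ

/-- Expressions: constants, (indirect) reads `a[i]`, sums and truncated differences. -/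
inductive Expr : Type
  | lit (c : ℕ) : Expr
  | get (a : ℕ) (i : Expr) : Expr
  | add (e₁ e₂ : Expr) : Expr
  | sub (e₁ e₂ : Expr) : Expr

/-- Value of an expression. -/
def Expr.eval (M : Mem) : Expr → ℕ
  | .lit c => c
  | .get a i => M a (i.eval M)
  | .add e₁ e₂ => e₁.eval M + e₂.eval M
  | .sub e₁ e₂ => e₁.eval M - e₂.eval M

/-- Programs.  `set a i e` is the assignment `a[i] := e`; a test `e` succeeds if `e ≠ 0`. -/
inductive Prog : Type
  | skip : Prog
  | set (a : ℕ) (i e : Expr) : Prog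
  | seq (p q : Prog) : Prog
  | ite (e : Expr) (p q : Prog) : Prog
  | loop (e : Expr) (p : Prog) : Prog

/-- The memory after `a[i] := v`. -/
def Mem.write (M : Mem) (a i v : ℕ) : Mem :=
  Function.update M a (Function.update (M a) i v)

/-- `Runs p M M' t`: started in memory `M`, the program `p` halts in memory `M'` after exactly `t`
steps, where every executed assignment, test and `skip` counts as one step. -/
inductive Runs : Prog → Mem → Mem → ℕ → Prop
  | skip (M : Mem) : Runs .skip M M 1
  | set (a : ℕ) (i e : Expr) (M : Mem) :
      Runs (.set a i e) M (M.write a (i.eval M) (e.eval M)) 1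
  | seq {p q : Prog} {M₁ M₂ M₃ : Mem} {s t : ℕ} :
      Runs p M₁ M₂ s → Runs q M₂ M₃ t → Runs (.seq p q) M₁ M₃ (s + t)
  | ite_true {e : Expr} {p q : Prog} {M M' : Mem} {t : ℕ} :
      e.eval M ≠ 0 → Runs p M M' t → Runs (.ite e p q) M M' (t + 1)
  | ite_false {e : Expr} {p q : Prog} {M M' : Mem} {t : ℕ} :
      e.eval M = 0 → Runs q M M' t → Runs (.ite e p q) M M' (t + 1)
  | loop_true {e : Expr} {p : Prog} {M₁ M₂ M₃ : Mem} {s t : ℕ} :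
      e.eval M₁ ≠ 0 → Runs p M₁ M₂ s → Runs (.loop e p) M₂ M₃ t →
        Runs (.loop e p) M₁ M₃ (s + t + 1)
  | loop_false {e : Expr} {p : Prog} {M : Mem} :
      e.eval M = 0 → Runs (.loop e p) M M 1

/-- Initial memory on input `(x, κ)`: the bits of `x` are in array `0`, the length of `x` is in
cell `0` of array `1`, `κ` is in cell `0` of array `2`, and every other cell is `0`. -/
def initMem (x : List Bool) (κ : ℕ) : Mem := fun a i =>
  if a = 0 then (x.getD i false).toNat
  else if a = 1 ∧ i = 0 then x.length
  else if a = 2 ∧ i = 0 then κ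
  else 0

/-- The memory `M` holds the output `(y, κ)`, in the same layout; the other cells are ignored. -/
def HoldsOutput (M : Mem) (y : List Bool) (κ : ℕ) : Prop :=
  (∀ i < y.length, M 0 i = (y.getD i false).toNat) ∧ M 1 0 = y.length ∧ M 2 0 = κ

/-! ### Parameterized problems, reductions, `W[1]` and `coW[1]` -/

/-- A parameterized problem: instances, encoded as bit strings, each with a parameter and a
yes/no answer. -/
structure ParamProblem where
  Inst : Type
  enc : Inst → List Bool
  enc_injective : Function.Injective enc
  param : Inst → ℕ
  Yes : Inst → Prop

/-- The complement: yes-instances and no-instances are exchanged. -/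
def ParamProblem.compl (P : ParamProblem) : ParamProblem :=
  { P with Yes := fun I => ¬ P.Yes I }

/-- There is a parameterized reduction from `P` to `Q`: a program that maps every instance of `P`
to an equivalent instance of `Q`, with parameter at most `g` of the old one, in at most
`f κ * (|x| + 1) ^ c` steps on an instance of parameter `κ` and encoding `x`, where `f` and `g` are
computable and `c` is a constant.  Delivering the output is charged one further step per bit (zero
bits need not have been written). -/
def Reduces (P Q : ParamProblem) : Prop :=
  ∃ (prog : Prog) (f g : ℕ → ℕ) (c : ℕ), Computable f ∧ Computable g ∧
    ∀ I : P.Inst, ∃ (J : Q.Inst) (M : Mem) (t : ℕ),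
      Runs prog (initMem (P.enc I) (P.param I)) M t ∧
      t + (Q.enc J).length ≤ f (P.param I) * ((P.enc I).length + 1) ^ c ∧
      HoldsOutput M (Q.enc J) (Q.param J) ∧
      Q.param J ≤ g (P.param I) ∧
      (P.Yes I ↔ Q.Yes J)

/-- A number in unary, with a terminator. -/
def unary (n : ℕ) : List Bool := List.replicate n true ++ [false]

theorem unary_append_inj : ∀ {a b : ℕ} {r s : List Bool},
    unary a ++ r = unary b ++ s → a = b ∧ r = s
  | 0, 0, r, s, h => by simpa [unary] using h
  | 0, b + 1, r, s, h => by simp [unary, List.replicate_succ] at h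
  | a + 1, 0, r, s, h => by simp [unary, List.replicate_succ] at h
  | a + 1, b + 1, r, s, h => by
      have h2 : unary a ++ r = unary b ++ s := by
        simpa [unary, List.replicate_succ] using h
      obtain ⟨h3, h4⟩ := unary_append_inj h2
      exact ⟨by rw [h3], h4⟩

/-- Concatenations of equally many blocks of an injective self-delimiting code are again
self-delimiting. -/
theorem ofFn_flatten_append_inj {α : Type*} (code : α → List Bool)
    (hc : ∀ x y r s, code x ++ r = code y ++ s → x = y ∧ r = s) :
    ∀ {n : ℕ} (u v : Fin n → α) (r s : List Bool),
      (List.ofFn fun i => code (u i)).flatten ++ r = (List.ofFn fun i => code (v i)).flatten ++ s →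
        u = v ∧ r = s
  | 0, u, v, r, s, h => ⟨funext fun i => i.elim0, by simpa using h⟩
  | n + 1, u, v, r, s, h => by
      simp only [List.ofFn_succ, List.flatten_cons, List.append_assoc] at h
      obtain ⟨h0, h1⟩ := hc _ _ _ _ h
      obtain ⟨h2, h3⟩ := ofFn_flatten_append_inj code hc _ _ _ _ h1
      refine ⟨funext fun i => ?_, h3⟩
      refine Fin.cases h0 (fun j => ?_) i
      exact congrFun h2 j

/-- An instance of Clique: an undirected graph and the size of the clique that is sought. -/
structure CliqueInst where
  n : ℕ
  k : ℕ
  G : SimpleGraph (Fin n)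

open Classical in
/-- `n` and `k` in unary, followed by the adjacency matrix, row by row. -/
noncomputable def CliqueInst.enc (I : CliqueInst) : List Bool :=
  unary I.n ++ (unary I.k ++
    (List.ofFn fun u => (List.ofFn fun v => [decide (I.G.Adj u v)]).flatten).flatten)

theorem CliqueInst.enc_injective : Function.Injective CliqueInst.enc := by
  rintro ⟨n, k, G⟩ ⟨n₂, k₂, G₂⟩ h
  simp only [CliqueInst.enc] at h
  obtain ⟨rfl, h⟩ := unary_append_inj h
  obtain ⟨rfl, h⟩ := unary_append_inj h
  classical
  have h2 := ofFn_flatten_append_inj (n := n)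
    (fun w : Fin n → Bool => (List.ofFn fun v => [w v]).flatten)
    (fun x y r s h => ofFn_flatten_append_inj (fun b : Bool => [b])
      (fun x y r s h => by simpa using h) x y r s h)
    (fun u v => decide (G.Adj u v)) (fun u v => decide (G₂.Adj u v)) [] []
    (by simpa only [List.append_nil] using h)
  have h3 : G = G₂ := by
    ext u v
    have := congrFun (congrFun h2.1 u) v
    simpa using this
  rw [h3]

/-- Clique, parameterized by the solution size. -/
noncomputable def clique : ParamProblem where
  Inst := CliqueInst
  enc := CliqueInst.enc
  enc_injective := CliqueInst.enc_injective
  param I := I.k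
  Yes I := ∃ S : Finset (Fin I.n), I.G.IsNClique I.k S

/-- The class `W[1]`: the closure of Clique, parameterized by the solution size, under
parameterized reductions. -/
def InW1 (P : ParamProblem) : Prop := Reduces P clique

/-- The class `coW[1]` of the complements of the problems in `W[1]`. -/
def InCoW1 (P : ParamProblem) : Prop := InW1 P.compl

/-- `Q` is `coW[1]`-hard: every problem in `coW[1]` has a parameterized reduction to `Q`. -/
def CoW1Hard (Q : ParamProblem) : Prop := ∀ P : ParamProblem, InCoW1 P → Reduces P Q

/-! ### Multi-layered assignment -/

/-- An instance `(A, I, P₁, …, P_ℓ, α, k, p)` of the verification problems, with agents `Fin n`,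
items `Fin m` and layers `Fin ℓ`.  The linear order of agent `a` in layer `j`, on the items that are
acceptable to it, is the duplicate-free list `pref j a`, most preferred item first; `none` stands
for the empty item `b_∅`. -/
structure VerifyInst where
  n : ℕ
  m : ℕ
  ℓ : ℕ
  α : ℕ
  k : ℕ
  pref : Fin ℓ → Fin n → List (Fin m)
  p : Fin n → Option (Fin m)
  one_le_α : 1 ≤ α
  α_le : α ≤ ℓ
  one_le_k : 1 ≤ k
  k_le : k ≤ n
  pref_nodup : ∀ j a, (pref j a).Nodup
  /-- no item is allocated to two agents -/
  p_inj : ∀ a₁ a₂ b, p a₁ = some b → p a₂ = some b → a₁ = a₂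
  /-- the assignment is legal: allocated items are acceptable to their owners -/
  p_legal : ∀ j a b, p a = some b → b ∈ pref j a

/-- `x <_a y` for an agent `a` with preference list `L`: it prefers `y` over `x`.  The empty item
is below all acceptable items. -/
def PrefLT {m : ℕ} (L : List (Fin m)) : Option (Fin m) → Option (Fin m) → Prop
  | some b, some c => b ∈ L ∧ c ∈ L ∧ L.idxOf c < L.idxOf b
  | none, some c => c ∈ L
  | _, none => False

namespace VerifyInst

variable (I : VerifyInst)

/-- The agents of `K`, and no others, form a trading cycle in layer `j`:
`(a 0, b 0, …, a r, b r)` with distinct agents, `p (a i) = b i`, and `a i` prefers `b (i + 1)` over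
`b i` (indices modulo `r + 1`). -/
def TradingCycle (j : Fin I.ℓ) (K : Finset (Fin I.n)) : Prop :=
  ∃ (r : ℕ) (a : Fin (r + 1) → Fin I.n) (b : Fin (r + 1) → Fin I.m),
    Function.Injective a ∧ Finset.univ.image a = K ∧
    ∀ i, I.p (a i) = some (b i) ∧ PrefLT (I.pref j (a i)) (some (b i)) (some (b (i + 1)))

/-- Agent `a` admits a self loop in layer `j`: it prefers some unallocated item over its own. -/
def SelfLoop (j : Fin I.ℓ) (a : Fin I.n) : Prop :=
  ∃ b : Fin I.m, (∀ a₂, I.p a₂ ≠ some b) ∧ PrefLT (I.pref j a) (I.p a) (some b)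

/-- There are `α` (distinct) layers that satisfy `Q`. -/
def InAlphaLayers (Q : Fin I.ℓ → Prop) : Prop :=
  ∃ S : Finset (Fin I.ℓ), S.card = I.α ∧ ∀ j ∈ S, Q j

/-- `p` is `(k, α)`-optimal. -/
def Optimal : Prop :=
  (2 ≤ I.k → ∀ K : Finset (Fin I.n), K.card = I.k →
    I.InAlphaLayers fun j => ¬ I.TradingCycle j K) ∧
  (I.k = 1 → ∀ a, I.InAlphaLayers fun j => ¬ I.SelfLoop j a)

/-- `p` is `(k, α)`-upper-bounded optimal. -/
def UpperBoundedOptimal : Prop :=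
  (∀ K : Finset (Fin I.n), K.card ≤ I.k →
    I.InAlphaLayers fun j => ¬ I.TradingCycle j K) ∧
  (∀ a, I.InAlphaLayers fun j => ¬ I.SelfLoop j a)

/-- `p` is `(k, α)`-subset optimal. -/
def SubsetOptimal : Prop :=
  (∀ K : Finset (Fin I.n), K.card = I.k →
    I.InAlphaLayers fun j => ¬ ∃ K₂ : Finset (Fin I.n), K ⊆ K₂ ∧ I.TradingCycle j K₂) ∧
  (I.k = 1 → ∀ a, I.InAlphaLayers fun j => ¬ I.SelfLoop j a)

/-- Code of `p a`: `0` for the empty item and `b + 1` for item `b`, in unary. -/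
def encItem {m : ℕ} : Option (Fin m) → List Bool
  | none => unary 0
  | some b => unary ((b : ℕ) + 1)

/-- Code of a preference list: its length, followed by its items, in unary. -/
def encPref {m : ℕ} : List (Fin m) → List Bool := fun L =>
  unary L.length ++ (L.map fun b : Fin m => unary (b : ℕ)).flatten

/-- The numbers `n, m, ℓ, α, k`, the assignment, and the preference lists, layer by layer and in
each layer agent by agent. -/
def enc : List Bool :=
  unary I.n ++ (unary I.m ++ (unary I.ℓ ++ (unary I.α ++ (unary I.k ++
    ((List.ofFn fun a => encItem (I.p a)).flatten ++
      (List.ofFn fun j => (List.ofFn fun a => encPref (I.pref j a)).flatten).flatten)))))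

theorem encItem_append_inj {m : ℕ} (x y : Option (Fin m)) (r s : List Bool)
    (h : encItem x ++ r = encItem y ++ s) : x = y ∧ r = s := by
  cases x <;> cases y <;> obtain ⟨h1, h2⟩ := unary_append_inj h
  · exact ⟨rfl, h2⟩
  · omega
  · omega
  · refine ⟨congrArg some (Fin.ext ?_), h2⟩
    omega

theorem encPref_append_inj {m : ℕ} (x y : List (Fin m)) (r s : List Bool)
    (h : encPref x ++ r = encPref y ++ s) : x = y ∧ r = s := by
  unfold encPref at h
  rw [List.append_assoc, List.append_assoc] at h
  obtain ⟨h1, h2⟩ := unary_append_inj h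
  clear h
  induction x generalizing y with
  | nil =>
    cases y with
    | nil => exact ⟨rfl, by simpa using h2⟩
    | cons b y => simp at h1
  | cons a x ih =>
    cases y with
    | nil => simp at h1
    | cons b y =>
      simp only [List.map_cons, List.flatten_cons, List.append_assoc] at h2
      obtain ⟨h3, h4⟩ := unary_append_inj h2
      obtain ⟨h5, h6⟩ := ih y (by simpa using h1) h4
      exact ⟨by rw [Fin.ext h3, h5], h6⟩

theorem enc_injective : Function.Injective enc := by
  rintro ⟨n, m, ℓ, α, k, pref, p, _, _, _, _, _, _, _⟩
    ⟨n₂, m₂, ℓ₂, α₂, k₂, pref₂, p₂, _, _, _, _, _, _, _⟩ h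
  dsimp only [enc] at h
  obtain ⟨h1, e1⟩ := unary_append_inj h
  obtain ⟨h2, e2⟩ := unary_append_inj e1
  obtain ⟨h3, e3⟩ := unary_append_inj e2
  obtain ⟨h4, e4⟩ := unary_append_inj e3
  obtain ⟨h5, e5⟩ := unary_append_inj e4
  subst h1 h2 h3 h4 h5
  obtain ⟨h6, e6⟩ := ofFn_flatten_append_inj _ encItem_append_inj p p₂ _ _ e5
  obtain ⟨h7, -⟩ := ofFn_flatten_append_inj
    (fun w : Fin n → List (Fin m) => (List.ofFn fun a => encPref (w a)).flatten)
    (fun x y r s h => ofFn_flatten_append_inj _ encPref_append_inj x y r s h)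
    pref pref₂ [] [] (by simpa only [List.append_nil] using e6)
  subst h6 h7
  rfl

end VerifyInst

/-- Verify Optimal Assignment, parameterized by `k + ℓ`. -/
def verifyOA : ParamProblem where
  Inst := VerifyInst
  enc := VerifyInst.enc
  enc_injective := VerifyInst.enc_injective
  param I := I.k + I.ℓ
  Yes I := I.Optimal

/-- Verify Upper-Bounded Optimal Assignment, parameterized by `k + ℓ`. -/
def verifyUOA : ParamProblem where
  Inst := VerifyInst
  enc := VerifyInst.enc
  enc_injective := VerifyInst.enc_injective
  param I := I.k + I.ℓ
  Yes I := I.UpperBoundedOptimal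

/-- Verify Subset Optimal Assignment, parameterized by `k + ℓ`. -/
def verifySOA : ParamProblem where
  Inst := VerifyInst
  enc := VerifyInst.enc
  enc_injective := VerifyInst.enc_injective
  param I := I.k + I.ℓ
  Yes I := I.SubsetOptimal

end ParamCx

/-!
The problems are reduced from Clique by one construction that serves all three notions of
optimality; composing it with a given reduction to Clique gives hardness.

Given a graph on `n` vertices and a number `k`, there are `k + 2` levels and one agent for every
level and every vertex, where the vertices are extended by one extra vertex.  Every agent owns one
item, so that a layer is an arbitrary loopless directed graph on the agents and there are no self
loops; moreover `α = 1`, and the size of the sought sets is `k + 2`.  In every layer the levels are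
arranged on a cycle, and edges lead only from a level to the next one.  Level `0` has a single agent
that takes part (the one of the extra vertex), so every trading cycle, in every layer, visits every
level exactly once (`bijective_level_of_cycle`) and has exactly `k + 2` agents.  Hence each of the
three properties fails if and only if one set of agents forms a trading cycle in all layers
(`CliqueInst.optimal_iff`, `CliqueInst.upperBoundedOptimal_iff`, `CliqueInst.subsetOptimal_iff`).
Such a set selects a vertex for each of the last `k` levels.  There is a layer for every pair
`(s, t)` of levels, in which `s` and `t` exchange their places on the cycle; for
`s = a + 1` and `a < t` this puts `t` right after `a`, and the edges between these two levels are
restricted to adjacent vertices.  Thus the selected vertices form a clique, and conversely (`CliqueInst.hasCommonCycle_iff`).  The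
second root level makes the sets have at least two agents even for `k = 0`.

The reduction is a program of the machine model.  Its correctness and running time rest on the
predicate `Emits`: a program appends a word, which depends on the values of the variables, to the
output, in time polynomial in a bound on these values.  `Emits` is preserved by sequencing, tests,
assignments to a new variable and bounded loops, and the code of the verification instance is a
nested iteration over levels and vertices (`verifyCode`), so that the program follows the shape of
this word.  Every cell is written before it is read, except for the input, so that the program can
be run on whatever memory the first reduction leaves behind (`runs_cliqueToVerify`).
-/

namespace ParamCx

/-! ### Executing programs with a cost bound -/

theorem Mem.write_self (M : Mem) (a i v : ℕ) : M.write a i v a i = v := by simp [Mem.write]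

theorem Mem.write_of_ne_array {a b : ℕ} (h : b ≠ a) (M : Mem) (i v : ℕ) :
    M.write a i v b = M b := by simp [Mem.write, h]

theorem Mem.write_of_ne_index {i j : ℕ} (h : j ≠ i) (M : Mem) (a v : ℕ) :
    M.write a i v a j = M a j := by simp [Mem.write, h]

theorem Runs.set_of_eq {a x y : ℕ} {i e : Expr} {M : Mem} (hi : i.eval M = x)
    (he : e.eval M = y) :
    Runs (.set a i e) M (M.write a x y) 1 :=
  hi ▸ he ▸ .set a i e M

/-- A loop whose body, started in a memory satisfying `Inv s`, reaches one satisfying `Inv (s + 1)`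
within `T` steps, and whose test fails for the first time under `Inv N`. -/
theorem Runs.loop_of_invariant {e : Expr} {p : Prog} (Inv : ℕ → Mem → Prop) (T N : ℕ)
    (step : ∀ s < N, ∀ M, Inv s M →
      e.eval M ≠ 0 ∧ ∃ M' t, Runs p M M' t ∧ t ≤ T ∧ Inv (s + 1) M')
    (halt : ∀ M, Inv N M → e.eval M = 0) (M : Mem) (h0 : Inv 0 M) :
    ∃ M' t, Runs (.loop e p) M M' t ∧ t ≤ N * (T + 1) + 1 ∧ Inv N M' := by
  have main : ∀ d s, s + d = N → ∀ M, Inv s M →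
      ∃ M' t, Runs (.loop e p) M M' t ∧ t ≤ d * (T + 1) + 1 ∧ Inv N M' := by
    intro d
    induction d with
    | zero =>
      intro s hs M hM
      obtain rfl : s = N := by omega
      exact ⟨M, 1, .loop_false (halt M hM), by omega, hM⟩
    | succ d ih =>
      intro s hs M hM
      obtain ⟨he, M₁, t₁, hr, ht, hI⟩ := step s (by omega) M hM
      obtain ⟨M₂, t₂, hr₂, ht₂, hI₂⟩ := ih (s + 1) (by omega) M₁ hI
      refine ⟨M₂, t₁ + t₂ + 1, .loop_true he hr hr₂, ?_, hI₂⟩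
      rw [Nat.succ_mul]
      omega
  exact main N 0 (by omega) M h0

/-! ### Boolean expressions -/

namespace Expr

/-- The negation of a truth value, where nonzero means true. -/
def not (e : Expr) : Expr := .sub (.lit 1) e

/-- Disjunction of truth values. -/
def or (e f : Expr) : Expr := .add e f

/-- Conjunction of truth values. -/
def and (e f : Expr) : Expr := not (or (not e) (not f))

/-- The test `e < f`. -/
def lt (e f : Expr) : Expr := .sub f e

/-- The test `e = f`. -/
def eq (e f : Expr) : Expr := not (or (lt e f) (lt f e))

/-- Equivalence of truth values. -/
def iff (e f : Expr) : Expr := or (and e f) (and (not e) (not f))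

variable (M : Mem) (e f : Expr)

theorem eval_not : (not e).eval M ≠ 0 ↔ ¬ e.eval M ≠ 0 := by simp only [not, eval]; omega

theorem eval_or : (or e f).eval M ≠ 0 ↔ e.eval M ≠ 0 ∨ f.eval M ≠ 0 := by
  simp only [or, eval]; omega

theorem eval_and : (and e f).eval M ≠ 0 ↔ e.eval M ≠ 0 ∧ f.eval M ≠ 0 := by
  simp only [and, eval_not, eval_or]; tauto

theorem eval_lt : (lt e f).eval M ≠ 0 ↔ e.eval M < f.eval M := by simp only [lt, eval]; omega

theorem eval_eq : (eq e f).eval M ≠ 0 ↔ e.eval M = f.eval M := by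
  simp only [eq, eval_not, eval_or, eval_lt]; omega

theorem eval_iff : (iff e f).eval M ≠ 0 ↔ (e.eval M ≠ 0 ↔ f.eval M ≠ 0) := by
  simp only [iff, eval_or, eval_and, eval_not]; tauto

end Expr

/-! ### Programs that append bits to the output -/

/-- The `i`-th program variable: cell `i` of array `4`. -/
def Expr.var (i : ℕ) : Expr := .get 4 (.lit i)

/-- The memory `M` represents the values `v` of the first `d` variables, all at most `B`, and agrees
with `S` on the arrays that output programs only read.  These programs write to array `0` (the
output), array `3` (whose cell `0` is the length of the output so far) and array `4` (the
variables). -/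
structure Represents (S : Mem) (B d : ℕ) (M : Mem) (v : ℕ → ℕ) : Prop where
  var : ∀ i < d, M 4 i = v i
  static : ∀ a, a ≠ 0 → a ≠ 3 → a ≠ 4 → M a = S a
  le : ∀ i, v i ≤ B

/-- From `M` to `M'` the word `w` has been appended to the output. -/
structure Appends (M M' : Mem) (w : List Bool) : Prop where
  length : M' 3 0 = M 3 0 + w.length
  old : ∀ i < M 3 0, M' 0 i = M 0 i
  new : ∀ i < w.length, M' 0 (M 3 0 + i) = (w.getD i false).toNat

/-- Given values of the variables `0, …, d - 1`, the program `p` appends the word `o S v` to the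
output, leaves these variables unchanged, and needs polynomial time in any bound `B` on the
variables.  The variables from `d` on are free for use by `p`. -/
def Emits (d : ℕ) (p : Prog) (o : Mem → (ℕ → ℕ) → List Bool) : Prop :=
  ∃ c e, ∀ S B M v, Represents S B d M v → ∃ M' t, Runs p M M' t ∧
    t + (o S v).length ≤ c * (B + 1) ^ e ∧ Represents S B d M' v ∧ Appends M M' (o S v)

theorem Represents.eval_var {S M : Mem} {B d : ℕ} {v : ℕ → ℕ} (h : Represents S B d M v) {i : ℕ}
    (hi : i < d) : (Expr.var i).eval M = v i := by
  simpa [Expr.var, Expr.eval] using h.var i hi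

theorem Represents.of_update {S M : Mem} {B d s : ℕ} {v : ℕ → ℕ}
    (h : Represents S B (d + 1) M (Function.update v d s)) (hv : ∀ i, v i ≤ B) :
    Represents S B d M v where
  var i hi := by rw [h.var i (by omega), Function.update_of_ne (by omega)]
  static := h.static
  le := hv

/-- Assigning to the first free variable. -/
theorem Represents.write {S M : Mem} {B d s : ℕ} {v : ℕ → ℕ} (h : Represents S B d M v)
    (hs : s ≤ B) : Represents S B (d + 1) (M.write 4 d s) (Function.update v d s) where
  var i hi := by
    by_cases hid : i = d
    · subst hid; simp [Mem.write_self]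
    · rw [Mem.write_of_ne_index hid, Function.update_of_ne hid, h.var i (by omega)]
  static a h0 h3 h4 := by rw [Mem.write_of_ne_array h4, h.static a h0 h3 h4]
  le i := by
    by_cases hid : i = d
    · subst hid; simpa using hs
    · rw [Function.update_of_ne hid]; exact h.le i

theorem Appends.nil (M : Mem) : Appends M M [] := ⟨by simp, by simp, by simp⟩

theorem Appends.append {M₁ M₂ M₃ : Mem} {w₁ w₂ : List Bool} (h₁ : Appends M₁ M₂ w₁)
    (h₂ : Appends M₂ M₃ w₂) : Appends M₁ M₃ (w₁ ++ w₂) where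
  length := by rw [h₂.length, h₁.length, List.length_append]; omega
  old i hi := by rw [h₂.old i (by rw [h₁.length]; omega), h₁.old i hi]
  new i hi := by
    rw [List.length_append] at hi
    by_cases h : i < w₁.length
    · rw [h₂.old _ (by rw [h₁.length]; omega), h₁.new i h, List.getD_append _ _ _ _ h]
    · rw [List.getD_append_right _ _ _ _ (by omega), ← h₂.new _ (by omega), h₁.length]
      congr 1; omega

theorem Appends.write_variable {M₁ M₂ : Mem} {w : List Bool} (h : Appends M₁ M₂ w) (i x : ℕ) :
    Appends M₁ (M₂.write 4 i x) w where
  length := by rw [Mem.write_of_ne_array (by decide), h.length]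
  old := by rw [Mem.write_of_ne_array (by decide)]; exact h.old
  new := by rw [Mem.write_of_ne_array (by decide)]; exact h.new

/-- `Emits` in terms of a simpler description of the emitted word. -/
theorem Emits.congr {d : ℕ} {p : Prog} {o o' : Mem → (ℕ → ℕ) → List Bool} (h : Emits d p o)
    (ho : ∀ S v, o S v = o' S v) : Emits d p o' := by
  obtain rfl : o = o' := funext₂ ho
  exact h

/-- Append the bit `b`. -/
def emitBit (b : Bool) : Prog :=
  .seq (.set 0 (.get 3 (.lit 0)) (.lit b.toNat))
    (.set 3 (.lit 0) (.add (.get 3 (.lit 0)) (.lit 1)))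

theorem Emits.bit (d : ℕ) (b : Bool) : Emits d (emitBit b) fun _ _ => [b] := by
  refine ⟨3, 0, fun S B M v h => ⟨_, _, .seq (.set _ _ _ _) (.set _ _ _ _), by simp, ?_, ?_⟩⟩
  · refine ⟨fun i hi => ?_, fun a h0 h3 h4 => ?_, h.le⟩
    · rw [Mem.write_of_ne_array (by decide), Mem.write_of_ne_array (by decide), h.var i hi]
    · rw [Mem.write_of_ne_array h3, Mem.write_of_ne_array h0, h.static a h0 h3 h4]
  · refine ⟨?_, fun i hi => ?_, fun i hi => ?_⟩
    · simp [Expr.eval, Mem.write]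
    · rw [Mem.write_of_ne_array (by decide)]
      exact Mem.write_of_ne_index (by simp only [Expr.eval]; omega) _ _ _
    · obtain rfl : i = 0 := by simpa using hi
      rw [Mem.write_of_ne_array (by decide)]
      simp [Expr.eval, Mem.write]

theorem Emits.seq {d : ℕ} {p q : Prog} {o₁ o₂ : Mem → (ℕ → ℕ) → List Bool} (hp : Emits d p o₁)
    (hq : Emits d q o₂) : Emits d (.seq p q) fun S v => o₁ S v ++ o₂ S v := by
  obtain ⟨c₁, e₁, h₁⟩ := hp
  obtain ⟨c₂, e₂, h₂⟩ := hq
  refine ⟨c₁ + c₂, e₁ + e₂, fun S B M v h => ?_⟩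
  obtain ⟨M₁, t₁, r₁, b₁, g₁, a₁⟩ := h₁ S B M v h
  obtain ⟨M₂, t₂, r₂, b₂, g₂, a₂⟩ := h₂ S B M₁ v g₁
  refine ⟨M₂, t₁ + t₂, .seq r₁ r₂, ?_, g₂, a₁.append a₂⟩
  have k₁ : (B + 1) ^ e₁ ≤ (B + 1) ^ (e₁ + e₂) := Nat.pow_le_pow_right (by omega) (by omega)
  have k₂ : (B + 1) ^ e₂ ≤ (B + 1) ^ (e₁ + e₂) := Nat.pow_le_pow_right (by omega) (by omega)
  have := Nat.mul_le_mul_left c₁ k₁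
  have := Nat.mul_le_mul_left c₂ k₂
  rw [List.length_append, Nat.add_mul]
  omega

open Classical in
theorem Emits.ite {d : ℕ} {e : Expr} {p : Prog} {o : Mem → (ℕ → ℕ) → List Bool}
    (c : Mem → (ℕ → ℕ) → Prop)
    (he : ∀ S B M v, Represents S B d M v → (e.eval M ≠ 0 ↔ c S v)) (hp : Emits d p o) :
    Emits d (.ite e p .skip) fun S v => if c S v then o S v else [] := by
  obtain ⟨c₁, e₁, h₁⟩ := hp
  refine ⟨c₁ + 2, e₁, fun S B M v h => ?_⟩
  have hpos : 1 ≤ (B + 1) ^ e₁ := Nat.one_le_pow _ _ (by omega)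
  rw [Nat.add_mul]
  by_cases hc : c S v
  · obtain ⟨M₁, t₁, r₁, b₁, g₁, a₁⟩ := h₁ S B M v h
    simp only [hc, if_true]
    exact ⟨M₁, t₁ + 1, .ite_true ((he S B M v h).2 hc) r₁, by omega, g₁, a₁⟩
  · have h0 : e.eval M = 0 := by
      by_contra h0
      exact hc ((he S B M v h).1 h0)
    simp only [hc, if_false]
    exact ⟨M, 1 + 1, .ite_false h0 (.skip M), by simp; omega, h, .nil M⟩

/-- Computing the value of the first free variable before running `p`. -/
theorem Emits.bind {d : ℕ} {p q : Prog} {o : Mem → (ℕ → ℕ) → List Bool} (g : (ℕ → ℕ) → ℕ) (T : ℕ)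
    (hg : ∀ v B, (∀ i, v i ≤ B) → g v ≤ B)
    (hq : ∀ S B M v, Represents S B d M v → ∃ t ≤ T, Runs q M (M.write 4 d (g v)) t)
    (hp : Emits (d + 1) p o) :
    Emits d (.seq q p) fun S v => o S (Function.update v d (g v)) := by
  obtain ⟨c, e, h₁⟩ := hp
  refine ⟨c + T, e, fun S B M v h => ?_⟩
  obtain ⟨t₀, ht₀, r₀⟩ := hq S B M v h
  obtain ⟨M₁, t₁, r₁, b₁, g₁, a₁⟩ := h₁ S B _ _ (h.write (hg v B h.le))
  refine ⟨M₁, t₀ + t₁, .seq r₀ r₁, ?_, g₁.of_update h.le, ?_⟩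
  · have := Nat.mul_le_mul_left T (Nat.one_le_pow e (B + 1) (by omega))
    rw [Nat.add_mul]
    change _ + (o S (Function.update v d (g v))).length ≤ _
    omega
  · simpa using ((Appends.nil M).write_variable d (g v)).append a₁

/-- Run `p` with the variable `d` taking the values from `0` up to, but not including, that of
variable `b`. -/
def forLoop (d b : ℕ) (p : Prog) : Prog :=
  .seq (.set 4 (.lit d) (.lit 0))
    (.loop (.lt (.var d) (.var b)) (.seq p (.set 4 (.lit d) (.add (.var d) (.lit 1)))))

theorem Emits.forLoop {d b : ℕ} (hb : b < d) {p : Prog} {o : Mem → (ℕ → ℕ) → List Bool}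
    (hp : Emits (d + 1) p o) :
    Emits d (forLoop d b p) fun S v =>
      (List.range (v b)).flatMap fun s => o S (Function.update v d s) := by
  obtain ⟨c, e, h₁⟩ := hp
  refine ⟨2 * c + 4, e + 1, fun S B M v h => ?_⟩
  set w : ℕ → List Bool := fun s =>
    (List.range s).flatMap fun s => o S (Function.update v d s) with hw
  have hsucc : ∀ s, w (s + 1) = w s ++ o S (Function.update v d s) := fun s => by
    simp [hw, List.range_succ]
  have step : ∀ s < v b, ∀ M₁,
      (Represents S B (d + 1) M₁ (Function.update v d s) ∧ Appends M M₁ (w s) ∧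
        (w s).length ≤ s * (c * (B + 1) ^ e)) →
      (Expr.lt (.var d) (.var b)).eval M₁ ≠ 0 ∧ ∃ M₂ t,
        Runs (.seq p (.set 4 (.lit d) (.add (.var d) (.lit 1)))) M₁ M₂ t ∧
        t ≤ c * (B + 1) ^ e + 1 ∧
        Represents S B (d + 1) M₂ (Function.update v d (s + 1)) ∧ Appends M M₂ (w (s + 1)) ∧
        (w (s + 1)).length ≤ (s + 1) * (c * (B + 1) ^ e) := by
    rintro s hs M₁ ⟨g₁, a₁, l₁⟩
    obtain ⟨M₂, t₂, r₂, b₂, g₂, a₂⟩ := h₁ S B M₁ _ g₁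
    refine ⟨?_, _, _, .seq r₂ (.set _ _ _ _), by omega, ?_, ?_, ?_⟩
    · rw [Expr.eval_lt, g₁.eval_var (by omega), g₁.eval_var (by omega)]
      simpa [Function.update_of_ne hb.ne] using hs
    · have h2 := (g₂.of_update h.le).write (s := s + 1) (by have := h.le b; omega)
      simpa [Expr.eval, g₂.eval_var] using h2
    · rw [hsucc]
      exact (a₁.append a₂).write_variable _ _
    · rw [hsucc, List.length_append, Nat.succ_mul]
      omega
  have halt : ∀ M₁,
      (Represents S B (d + 1) M₁ (Function.update v d (v b)) ∧ Appends M M₁ (w (v b)) ∧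
        (w (v b)).length ≤ v b * (c * (B + 1) ^ e)) →
      (Expr.lt (.var d) (.var b)).eval M₁ = 0 := by
    rintro M₁ ⟨g₁, -, -⟩
    by_contra h0
    rw [← ne_eq, Expr.eval_lt, g₁.eval_var (by omega), g₁.eval_var (by omega)] at h0
    simp [Function.update_of_ne hb.ne] at h0
  obtain ⟨M₁, t₁, r₁, b₁, g₁, a₁, l₁⟩ := Runs.loop_of_invariant
    (fun s M₁ => Represents S B (d + 1) M₁ (Function.update v d s) ∧ Appends M M₁ (w s) ∧
      (w s).length ≤ s * (c * (B + 1) ^ e)) _ _ step halt (M.write 4 d 0)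
    ⟨h.write (Nat.zero_le B), by simpa [hw] using (Appends.nil M).write_variable d 0,
      by simp [hw]⟩
  refine ⟨M₁, _, .seq (.set _ _ _ _) r₁, ?_, g₁.of_update h.le, a₁⟩
  have h2 := h.le b
  have h3 : (w (v b)).length ≤ B * (c * (B + 1) ^ e) := l₁.trans (Nat.mul_le_mul_right _ h2)
  change _ + (w (v b)).length ≤ _
  rw [Nat.pow_succ]
  have hX : 1 ≤ (B + 1) ^ e := Nat.one_le_pow _ _ (by omega)
  generalize (B + 1) ^ e = X at b₁ h3 hX ⊢
  have h5 : v b * (c * X + 1 + 1) ≤ B * (c * X + 1 + 1) := Nat.mul_le_mul_right _ h2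
  nlinarith [Nat.mul_le_mul_right B hX, Nat.zero_le (c * X)]

/-! ### The verification instance of a graph -/

/-- A single trading edge, on natural numbers.  In the layer `(s, t)` the `L` levels are arranged on
a cycle.  The agent at level `a`, which has position `p` on this cycle, with vertex `u` prefers the
item of the agent at level `b`, which has position `q`, with vertex `v` if `q` follows `p`, both
agents are valid (levels `0` and `1` use only the extra vertex `n`, which no other level uses), and,
when the step leads from level `s - 1` to level `t`, the vertices are adjacent or one of them is the
extra vertex. -/
def TradeEdge (adj : ℕ → ℕ → Prop) (n L s t p q a u b v : ℕ) : Prop :=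
  ((a < 2 ↔ u = n) ∧ (b < 2 ↔ v = n)) ∧
  (q = p + 1 ∨ (p + 1 = L ∧ q = 0)) ∧
  (a + 1 = s ∧ b = t → u = n ∨ v = n ∨ adj u v)

/-- Adjacency in `G`, on natural numbers. -/
def CliqueInst.adj (J : CliqueInst) (u v : ℕ) : Prop :=
  ∃ (hu : u < J.n) (hv : v < J.n), J.G.Adj ⟨u, hu⟩ ⟨v, hv⟩

/-- The number of levels: two root levels, and one for each vertex of the clique. -/
abbrev CliqueInst.levels (J : CliqueInst) : ℕ := J.k + 2

/-- The trading graph in layer `j` on the agents; the layer `s * levels + t` stands for the pair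
`(s, t)` of levels, the agent `a * (n + 1) + u` for level `a` and vertex `u`.  In the layer `(s, t)`
the levels are arranged in their natural cyclic order, except that `s` and `t` are exchanged. -/
def CliqueInst.edge (J : CliqueInst) (j x y : ℕ) : Prop :=
  let s := j / J.levels
  let t := j % J.levels
  let a := x / (J.n + 1)
  let b := y / (J.n + 1)
  TradeEdge J.adj J.n J.levels s t (Equiv.swap s t a) (Equiv.swap s t b)
    a (x % (J.n + 1)) b (y % (J.n + 1))

theorem CliqueInst.edge_irrefl (J : CliqueInst) (j x : ℕ) : ¬ J.edge j x x := by
  rintro ⟨-, h | h, -⟩ <;> simp only [CliqueInst.levels] at h <;> omega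

open Classical in
/-- The instance of the verification problems that is a no-instance if and only if the graph has a
clique of the required size.  Every agent owns the item of the same number, and finds acceptable,
besides its own item, those of its out-neighbours in the trading graph, all of which it prefers to
its own. -/
noncomputable def CliqueInst.toVerify (J : CliqueInst) : VerifyInst where
  n := J.levels * (J.n + 1)
  m := J.levels * (J.n + 1)
  ℓ := J.levels * J.levels
  α := 1
  k := J.levels
  pref j x := (List.finRange _).filter (fun y : Fin _ => J.edge j x y) ++ [x]
  p x := some x
  one_le_α := le_rfl
  α_le := Nat.mul_pos (Nat.succ_pos _) (Nat.succ_pos _)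
  one_le_k := Nat.succ_pos _
  k_le := Nat.le_mul_of_pos_right _ (Nat.succ_pos _)
  pref_nodup j x := by
    rw [List.nodup_append]
    refine ⟨(List.nodup_finRange _).filter _, List.nodup_singleton _, fun y hy z hz => ?_⟩
    simp only [List.mem_filter, List.mem_singleton, decide_eq_true_eq] at hy hz
    rintro rfl
    exact J.edge_irrefl _ _ (hz ▸ hy.2)
  p_inj x y b hx hy := by simp_all
  p_legal j x b h := by simp_all

/-- An agent whose own item comes last in its list prefers exactly the other items of the list. -/
theorem prefLT_append_singleton {m : ℕ} {l : List (Fin m)} {x : Fin m} (hx : x ∉ l) (y : Fin m) :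
    PrefLT (l ++ [x]) (some x) (some y) ↔ y ∈ l := by
  rw [PrefLT, List.idxOf_append_of_notMem hx]
  constructor
  · rintro ⟨-, h, h2⟩
    by_contra h3
    rw [List.idxOf_append_of_notMem h3] at h2
    have : y = x := by simpa [h3] using h
    simp [this] at h2
  · intro h
    rw [List.idxOf_append_of_mem h]
    have := List.idxOf_lt_length_of_mem h
    exact ⟨by simp, by simp [h], by omega⟩

/-! ### Cycles that run through all levels -/

theorem exists_nsmul_one {k : ℕ} (x : Fin (k + 1)) : ∃ m : ℕ, m • (1 : Fin (k + 1)) = x := by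
  induction x using Fin.induction with
  | zero => exact ⟨0, zero_nsmul _⟩
  | succ i ih =>
    obtain ⟨m, hm⟩ := ih
    exact ⟨m + 1, by rw [succ_nsmul, hm, Fin.coeSucc_eq_succ]⟩

/-- If every step of a cycle goes to the next of `k + 1` cyclically arranged levels, and some level
contains at most one element of the cycle, then the cycle visits every level exactly once: two
visits to any level could be shifted to two visits to the singleton level. -/
theorem bijective_level_of_cycle {r k : ℕ} {β : Type*} (c : Fin (r + 1) → β)
    (hc : Function.Injective c) (lev : β → Fin (k + 1))
    (hstep : ∀ i, lev (c (i + 1)) = lev (c i) + 1) (q : Fin (k + 1))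
    (hq : ∀ i j, lev (c i) = q → lev (c j) = q → c i = c j) :
    Function.Bijective fun i => lev (c i) := by
  -- moving `m` steps along the cycle adds `m` to the level
  have shift : ∀ (m : ℕ) i, lev (c (i + m • 1)) = lev (c i) + m • 1 := by
    intro m
    induction m with
    | zero => simp
    | succ m ih => intro i; rw [succ_nsmul, ← add_assoc, hstep, ih, succ_nsmul, add_assoc]
  constructor
  · intro i j hij
    obtain ⟨m, hm⟩ := exists_nsmul_one (q - lev (c i))
    have hi : lev (c (i + m • 1)) = q := by rw [shift, hm, add_sub_cancel]
    have hj : lev (c (j + m • 1)) = q := by 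
      rw [shift, ← show lev (c i) = lev (c j) from hij, hm, add_sub_cancel]
    exact add_right_cancel (hc (hq _ _ hi hj))
  · intro x
    obtain ⟨m, hm⟩ := exists_nsmul_one (x - lev (c 0))
    exact ⟨0 + m • 1, by beta_reduce; rw [shift, hm, add_sub_cancel]⟩

namespace CliqueInst

variable (J : CliqueInst)

theorem prefLT_iff (j : Fin J.toVerify.ℓ) (x y : Fin J.toVerify.n) :
    PrefLT (J.toVerify.pref j x) (some x) (some y) ↔ J.edge j x y := by
  classical
  refine (prefLT_append_singleton (l := (List.finRange _).filter (fun y : Fin _ => J.edge j x y))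
    (by simpa using J.edge_irrefl _ _) y).trans ?_
  simp

theorem tradingCycle_iff (j : Fin J.toVerify.ℓ) (K : Finset (Fin J.toVerify.n)) :
    J.toVerify.TradingCycle j K ↔ ∃ (r : ℕ) (c : Fin (r + 1) → Fin J.toVerify.n),
      Function.Injective c ∧ Finset.univ.image c = K ∧ ∀ i, J.edge j (c i) (c (i + 1)) := by
  constructor
  · rintro ⟨r, c, b, hc, hK, h⟩
    have hb : ∀ i, c i = b i := fun i => Option.some.inj (h i).1
    obtain rfl : c = b := funext hb
    exact ⟨r, c, hc, hK, fun i => (J.prefLT_iff _ _ _).1 (h i).2⟩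
  · rintro ⟨r, c, hc, hK, h⟩
    exact ⟨r, c, c, hc, hK, fun i => ⟨rfl, (J.prefLT_iff _ _ _).2 (h i)⟩⟩

theorem not_selfLoop (j : Fin J.toVerify.ℓ) (x : Fin J.toVerify.n) :
    ¬ J.toVerify.SelfLoop j x := by
  rintro ⟨b, hb, -⟩
  exact hb b rfl

/-- As `α = 1`, a single layer suffices. -/
theorem inAlphaLayers_iff (Q : Fin J.toVerify.ℓ → Prop) :
    J.toVerify.InAlphaLayers Q ↔ ∃ j, Q j := by
  constructor
  · rintro ⟨S, hS, h⟩
    obtain ⟨j, rfl⟩ := Finset.card_eq_one.1 (show S.card = 1 from hS)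
    exact ⟨j, h j (Finset.mem_singleton_self j)⟩
  · rintro ⟨j, hj⟩
    exact ⟨{j}, Finset.card_singleton j, by simpa using hj⟩

/-- The level of an agent. -/
def level (x : Fin J.toVerify.n) : Fin J.levels :=
  ⟨x / (J.n + 1), Nat.div_lt_of_lt_mul (by rw [Nat.mul_comm]; exact x.2)⟩

/-- The vertex of an agent. -/
def vertex (x : Fin J.toVerify.n) : Fin (J.n + 1) :=
  ⟨x % (J.n + 1), Nat.mod_lt _ (Nat.succ_pos _)⟩

/-- The agent with a given level and vertex. -/
def agent (a : Fin J.levels) (u : Fin (J.n + 1)) : Fin J.toVerify.n :=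
  ⟨a * (J.n + 1) + u, by
    have h := Nat.mul_le_mul_right (J.n + 1) (Nat.succ_le_of_lt a.2)
    have := u.2
    rw [Nat.succ_mul] at h
    exact lt_of_lt_of_le (by omega) h⟩

theorem agent_ext {x y : Fin J.toVerify.n} (h1 : J.level x = J.level y)
    (h2 : J.vertex x = J.vertex y) : x = y := by
  have h1 := congrArg Fin.val h1
  have h2 := congrArg Fin.val h2
  simp only [level, vertex] at h1 h2
  apply Fin.ext
  rw [← Nat.div_add_mod x (J.n + 1), h1, h2, Nat.div_add_mod]

theorem level_agent (a : Fin J.levels) (u : Fin (J.n + 1)) : J.level (J.agent a u) = a := by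
  apply Fin.ext
  simp only [level, agent]
  rw [Nat.mul_comm, Nat.mul_add_div (Nat.succ_pos _), Nat.div_eq_of_lt u.2, Nat.add_zero]

theorem vertex_agent (a : Fin J.levels) (u : Fin (J.n + 1)) : J.vertex (J.agent a u) = u := by
  apply Fin.ext
  simp only [vertex, agent]
  rw [Nat.mul_comm, Nat.mul_add_mod, Nat.mod_eq_of_lt u.2]

/-- The layer that stands for a pair of levels. -/
def layer (s t : Fin J.levels) : Fin J.toVerify.ℓ :=
  ⟨s * J.levels + t, by
    have h := Nat.mul_le_mul_right J.levels (Nat.succ_le_of_lt s.2)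
    have := t.2
    rw [Nat.succ_mul] at h
    exact lt_of_lt_of_le (by omega) h⟩

theorem exists_layer (j : Fin J.toVerify.ℓ) : ∃ s t, j = J.layer s t := by
  refine ⟨⟨j / J.levels, Nat.div_lt_of_lt_mul j.2⟩,
    ⟨j % J.levels, Nat.mod_lt _ (Nat.succ_pos _)⟩, ?_⟩
  refine Fin.ext (Eq.symm ?_)
  change (j : ℕ) / J.levels * J.levels + j % J.levels = j
  rw [Nat.mul_comm, Nat.div_add_mod]

theorem val_swap {N : ℕ} (s t a : Fin N) :
    Equiv.swap (s : ℕ) t a = (Equiv.swap s t a : Fin N) := by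
  simp only [Equiv.swap_apply_def, Fin.ext_iff]
  split_ifs <;> rfl

/-- Addition in `Fin (k + 2)` is cyclic. -/
theorem val_eq_next_iff {k : ℕ} (p q : Fin (k + 2)) :
    ((q : ℕ) = p + 1 ∨ ((p : ℕ) + 1 = k + 2 ∧ (q : ℕ) = 0)) ↔ q = p + 1 := by
  rw [Fin.ext_iff, Fin.val_add_one]
  have := p.2
  have := q.2
  split_ifs with h
  · rw [h, Fin.val_last]
    omega
  · have : (p : ℕ) ≠ k + 1 := fun h2 => h (Fin.ext h2)
    omega

/-- Trading edges in terms of levels and vertices. -/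
theorem edge_layer_iff (s t : Fin J.levels) (x y : Fin J.toVerify.n) :
    J.edge (J.layer s t) x y ↔
      (((J.level x : ℕ) < 2 ↔ (J.vertex x : ℕ) = J.n) ∧
        ((J.level y : ℕ) < 2 ↔ (J.vertex y : ℕ) = J.n)) ∧
      Equiv.swap s t (J.level y) = Equiv.swap s t (J.level x) + 1 ∧
      ((J.level x : ℕ) + 1 = s ∧ J.level y = t →
        (J.vertex x : ℕ) = J.n ∨ (J.vertex y : ℕ) = J.n ∨ J.adj (J.vertex x) (J.vertex y)) := by
  have hs : (J.layer s t : ℕ) / J.levels = s := by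
    change ((s : ℕ) * J.levels + t) / J.levels = s
    rw [Nat.mul_comm, Nat.mul_add_div (Nat.succ_pos _), Nat.div_eq_of_lt t.2, Nat.add_zero]
  have ht : (J.layer s t : ℕ) % J.levels = t := by
    change ((s : ℕ) * J.levels + t) % J.levels = t
    rw [Nat.mul_comm, Nat.mul_add_mod, Nat.mod_eq_of_lt t.2]
  rw [← val_eq_next_iff, ← val_swap, ← val_swap, edge, TradeEdge, hs, ht, Fin.ext_iff (b := t)]
  rfl

/-- A trading cycle visits every level exactly once. -/
theorem bijective_level_comp {s t : Fin J.levels} {r : ℕ} {c : Fin (r + 1) → Fin J.toVerify.n}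
    (hc : Function.Injective c) (h : ∀ i, J.edge (J.layer s t) (c i) (c (i + 1))) :
    Function.Bijective fun i => J.level (c i) := by
  simp only [edge_layer_iff] at h
  have key := bijective_level_of_cycle c hc (fun x => Equiv.swap s t (J.level x))
    (fun i => (h i).2.1) (Equiv.swap s t 0) fun i j hi hj => by
      have hi := (Equiv.swap s t).injective hi
      have hj := (Equiv.swap s t).injective hj
      refine J.agent_ext (hi.trans hj.symm) (Fin.ext ?_)
      rw [(h i).1.1.1 (by rw [hi]; exact Nat.succ_pos _),
        (h j).1.1.1 (by rw [hj]; exact Nat.succ_pos _)]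
  exact ((Equiv.swap s t).bijective.of_comp_iff' _).1 key

/-- All trading cycles, in whatever layer, have the same number of agents; this makes the three
notions of optimality agree. -/
theorem card_of_tradingCycle {j : Fin J.toVerify.ℓ} {K : Finset (Fin J.toVerify.n)}
    (h : J.toVerify.TradingCycle j K) : K.card = J.levels := by
  obtain ⟨s, t, rfl⟩ := J.exists_layer j
  obtain ⟨r, c, hc, rfl, hstep⟩ := (J.tradingCycle_iff _ _).1 h
  have := Fintype.card_of_bijective (J.bijective_level_comp hc hstep)
  rw [Finset.card_image_of_injective _ hc, Finset.card_univ, this, Fintype.card_fin]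

/-- Some set of agents admits a trading cycle in every layer. -/
def HasCommonCycle : Prop := ∃ K, ∀ j, J.toVerify.TradingCycle j K

theorem optimal_iff : J.toVerify.Optimal ↔ ¬ J.HasCommonCycle := by
  simp only [VerifyInst.Optimal, inAlphaLayers_iff, HasCommonCycle, not_exists, not_forall]
  constructor
  · intro h K
    by_cases hK : K.card = J.levels
    · exact h.1 (Nat.le_add_left _ _) K hK
    · exact ⟨J.layer 0 0, fun h => hK (J.card_of_tradingCycle h)⟩
  · refine fun h => ⟨fun _ K _ => h K, fun h2 => ?_⟩
    exact absurd (show J.k + 2 = 1 from h2) (by omega)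

theorem upperBoundedOptimal_iff : J.toVerify.UpperBoundedOptimal ↔ ¬ J.HasCommonCycle := by
  simp only [VerifyInst.UpperBoundedOptimal, inAlphaLayers_iff, HasCommonCycle, not_exists,
    not_forall]
  constructor
  · intro h K
    by_cases hK : K.card = J.levels
    · exact h.1 K hK.le
    · exact ⟨J.layer 0 0, fun h => hK (J.card_of_tradingCycle h)⟩
  · exact fun h => ⟨fun K _ => h K, fun a => ⟨J.layer 0 0, J.not_selfLoop _ _⟩⟩

theorem subsetOptimal_iff : J.toVerify.SubsetOptimal ↔ ¬ J.HasCommonCycle := by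
  simp only [VerifyInst.SubsetOptimal, inAlphaLayers_iff, HasCommonCycle, not_exists, not_forall]
  constructor
  · intro h K
    by_cases hK : K.card = J.levels
    · obtain ⟨j, hj⟩ := h.1 K hK
      exact ⟨j, fun h => hj K ⟨subset_rfl, h⟩⟩
    · exact ⟨J.layer 0 0, fun h => hK (J.card_of_tradingCycle h)⟩
  · refine fun h => ⟨fun K hK => ?_, fun h2 => ?_⟩
    · obtain ⟨j, hj⟩ := h K
      refine ⟨j, fun K₂ ⟨hsub, h₂⟩ => hj ?_⟩
      -- a cycle through a superset of `K` has as many agents as `K`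
      rwa [Finset.eq_of_subset_of_card_le hsub
        ((J.card_of_tradingCycle h₂).trans (Eq.symm hK)).le]
    · exact absurd (show J.k + 2 = 1 from h2) (by omega)

/-- In the layer `(a + 1, b)`, a trading cycle goes from its agent at level `a` to its agent at
level `b`, so that their vertices are adjacent. -/
theorem adj_of_tradingCycle {K : Finset (Fin J.toVerify.n)} {a a' b : Fin J.levels}
    (ha : (a' : ℕ) = a + 1) (hab : a < b) (h : J.toVerify.TradingCycle (J.layer a' b) K)
    {x y : Fin J.toVerify.n} (hx : x ∈ K) (hy : y ∈ K) (hxa : J.level x = a)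
    (hyb : J.level y = b) :
    (J.vertex x : ℕ) = J.n ∨ (J.vertex y : ℕ) = J.n ∨ J.adj (J.vertex x) (J.vertex y) := by
  obtain ⟨r, c, hc, rfl, hstep⟩ := (J.tradingCycle_iff _ _).1 h
  have hbij := J.bijective_level_comp hc hstep
  simp only [Finset.mem_image, Finset.mem_univ, true_and] at hx hy
  obtain ⟨i, rfl⟩ := hx
  obtain ⟨i', rfl⟩ := hy
  have hi := (J.edge_layer_iff _ _ _ _).1 (hstep i)
  have hnext : J.level (c (i + 1)) = b := by
    have h1 := hi.2.1
    rw [hxa, Equiv.swap_apply_of_ne_of_ne (Fin.ne_of_val_ne (by omega)) hab.ne] at h1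
    apply (Equiv.swap a' b).injective
    rw [h1, Equiv.swap_apply_right]
    exact ((val_eq_next_iff a a').1 (Or.inl ha)).symm
  obtain rfl : i + 1 = i' := hbij.1 (hnext.trans hyb.symm)
  exact hi.2.2 ⟨by rw [hxa, ha], hyb⟩

/-- A trading cycle contains an agent of every level; only at the two root levels can its vertex be
the extra one. -/
theorem vertex_of_tradingCycle {j : Fin J.toVerify.ℓ} {K : Finset (Fin J.toVerify.n)}
    (h : J.toVerify.TradingCycle j K) (a : Fin J.levels) :
    ∃ x ∈ K, J.level x = a ∧ (2 ≤ (a : ℕ) → (J.vertex x : ℕ) ≠ J.n) := by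
  obtain ⟨s, t, rfl⟩ := J.exists_layer j
  obtain ⟨r, c, hc, rfl, hstep⟩ := (J.tradingCycle_iff _ _).1 h
  obtain ⟨i, hi⟩ := (J.bijective_level_comp hc hstep).2 a
  have hi2 := ((J.edge_layer_iff _ _ _ _).1 (hstep i)).1.1
  refine ⟨c i, Finset.mem_image_of_mem _ (Finset.mem_univ i), hi, fun ha hv => ?_⟩
  have := hi2.2 hv
  rw [show J.level (c i) = a from hi] at this
  omega

theorem adj_val_iff (u v : Fin J.n) : J.adj u v ↔ J.G.Adj u v :=
  ⟨fun ⟨_, _, h⟩ => h, fun h => ⟨u.2, v.2, h⟩⟩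

/-! ### Cliques and common trading cycles -/

theorem exists_isNClique_of_hasCommonCycle (h : J.HasCommonCycle) :
    ∃ S : Finset (Fin J.n), J.G.IsNClique J.k S := by
  obtain ⟨K, hK⟩ := h
  choose x hxK hxl hxv using J.vertex_of_tradingCycle (hK (J.layer 0 0))
  let a : Fin J.k → Fin J.levels := fun q => ⟨q + 2, Nat.add_lt_add_right q.2 2⟩
  have hne : ∀ q, (J.vertex (x (a q)) : ℕ) ≠ J.n := fun q => hxv (a q) (Nat.le_add_left _ _)
  let f : Fin J.k → Fin J.n := fun q =>
    ⟨J.vertex (x (a q)), lt_of_le_of_ne (Nat.le_of_lt_succ (J.vertex _).2) (hne q)⟩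
  have hlt : ∀ q q', q < q' → J.G.Adj (f q) (f q') := by
    intro q q' hqq
    have hqq' : (q : ℕ) < q' := hqq
    have := J.adj_of_tradingCycle (a := a q) (b := a q')
      (a' := ⟨q + 3, by have := q'.2; change _ < J.k + 2; omega⟩) rfl
      (show (q : ℕ) + 2 < q' + 2 by omega) (hK _) (hxK _) (hxK _) (hxl _) (hxl _)
    exact (J.adj_val_iff _ _).1 ((this.resolve_left (hne q)).resolve_left (hne q'))
  have hadj : ∀ q q', q ≠ q' → J.G.Adj (f q) (f q') := fun q q' hqq =>
    (lt_or_gt_of_ne hqq).elim (hlt q q') fun h => (hlt q' q h).symm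
  have hinj : Function.Injective f := fun q q' hf => by
    by_contra hqq
    exact (hadj q q' hqq).ne hf
  refine ⟨Finset.univ.image f, ?_, by rw [Finset.card_image_of_injective _ hinj, Finset.card_fin]⟩
  rintro u hu v hv huv
  simp only [Finset.coe_image, Finset.coe_univ, Set.image_univ, Set.mem_range] at hu hv
  obtain ⟨q, rfl⟩ := hu
  obtain ⟨q', rfl⟩ := hv
  exact hadj q q' fun h => huv (h ▸ rfl)

theorem hasCommonCycle_of_isNClique {S : Finset (Fin J.n)} (hS : J.G.IsNClique J.k S) :
    J.HasCommonCycle := by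
  let f : Fin J.k ≃ S := (Finset.equivFinOfCardEq hS.card_eq).symm
  -- the root levels use the extra vertex, the others the vertices of the clique
  let F : Fin J.levels → Fin (J.n + 1) := fun a =>
    if h : 2 ≤ (a : ℕ) then
      (f ⟨a - 2, by have : (a : ℕ) < J.k + 2 := a.2; omega⟩ : Fin J.n).castSucc
    else Fin.last _
  have hF : ∀ a : Fin J.levels, (a : ℕ) < 2 ↔ (F a : ℕ) = J.n := by
    intro a
    by_cases h : 2 ≤ (a : ℕ)
    · simp only [F, h, dif_pos, Fin.val_castSucc]
      have := (f ⟨a - 2, by have : (a : ℕ) < J.k + 2 := a.2; omega⟩ : Fin J.n).2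
      omega
    · simp only [F, h, dif_neg, not_false_eq_true, Fin.val_last, iff_true]
      omega
  have hadj : ∀ a b : Fin J.levels, a ≠ b →
      (F a : ℕ) = J.n ∨ (F b : ℕ) = J.n ∨ J.adj (F a) (F b) := by
    intro a b hab
    by_cases ha : 2 ≤ (a : ℕ)
    · by_cases hb : 2 ≤ (b : ℕ)
      · refine Or.inr (Or.inr ?_)
        simp only [F, ha, hb, dif_pos, Fin.val_castSucc, adj_val_iff]
        refine hS.isClique (Subtype.coe_prop _) (Subtype.coe_prop _) fun h => hab ?_
        have := congrArg Fin.val (f.injective (Subtype.ext h))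
        simp only at this
        exact Fin.ext (by omega)
      · exact Or.inr (Or.inl ((hF b).1 (by omega)))
    · exact Or.inl ((hF a).1 (by omega))
  refine ⟨Finset.univ.image fun a => J.agent a (F a), fun j => ?_⟩
  obtain ⟨s, t, rfl⟩ := J.exists_layer j
  have hinj : Function.Injective fun a => J.agent a (F a) := fun a b h => by
    simpa only [level_agent] using congrArg J.level h
  refine (J.tradingCycle_iff _ _).2 ⟨J.k + 1,
    fun i => J.agent (Equiv.swap s t i) (F (Equiv.swap s t i)),
    hinj.comp (Equiv.swap s t).injective, ?_, fun i => ?_⟩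
  · ext x
    simp only [Finset.mem_image, Finset.mem_univ, true_and]
    exact ((Equiv.swap s t).surjective.exists (p := fun a => J.agent a (F a) = x)).symm
  · rw [edge_layer_iff]
    simp only [level_agent, vertex_agent]
    refine ⟨⟨hF _, hF _⟩, by simp, fun _ => hadj _ _ fun h => ?_⟩
    have := (Equiv.swap s t).injective h
    simp at this

theorem hasCommonCycle_iff : J.HasCommonCycle ↔ clique.Yes J :=
  ⟨J.exists_isNClique_of_hasCommonCycle, fun ⟨_, hS⟩ => J.hasCommonCycle_of_isNClique hS⟩

end CliqueInst

/-! ### Encodings as nested loops -/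

theorem flatten_ofFn_eq_flatMap_range {α : Type*} (n : ℕ) (g : ℕ → List α) :
    (List.ofFn fun i : Fin n => g i).flatten = (List.range n).flatMap g := by
  rw [List.ofFn_eq_map, ← List.map_coe_finRange_eq_range, List.flatMap_def, List.map_map]
  rfl

theorem flatMap_range_mul {α : Type*} (a b : ℕ) (g : ℕ → List α) :
    (List.range (a * b)).flatMap g =
      (List.range a).flatMap fun i => (List.range b).flatMap fun u => g (i * b + u) := by
  induction a with
  | zero => simp
  | succ a ih =>
    rw [Nat.succ_mul, List.range_add, List.flatMap_append, ih, List.range_succ,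
      List.flatMap_append, List.flatMap_map]
    simp

theorem flatMap_range_congr {α : Type*} {n : ℕ} {f g : ℕ → List α} (h : ∀ i < n, f i = g i) :
    (List.range n).flatMap f = (List.range n).flatMap g :=
  List.flatMap_congr fun i hi => h i (List.mem_range.1 hi)

theorem flatMap_range_true (n : ℕ) :
    ((List.range n).flatMap fun _ => [true]) = List.replicate n true := by
  induction n with
  | zero => rfl
  | succ n ih => rw [List.range_succ, List.flatMap_append, ih, List.replicate_succ']; simp

theorem flatMap_range_replicate (m n : ℕ) :
    ((List.range m).flatMap fun _ => List.replicate n true) = List.replicate (m * n) true := by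
  rw [← flatMap_range_true (m * n), flatMap_range_mul]
  simp only [flatMap_range_true]

open Classical in
/-- The code of the preference list of the agent at level `a` with vertex `u`, in the layer
`(s, t)`. -/
noncomputable def prefCode (adj : ℕ → ℕ → Prop) (n L m s t a u : ℕ) : List Bool :=
  ((List.range L).flatMap fun b => (List.range m).flatMap fun v =>
    if TradeEdge adj n L s t (Equiv.swap s t a) (Equiv.swap s t b) a u b v then [true] else []) ++
  ([true] ++ ([false] ++
  (((List.range L).flatMap fun b => (List.range m).flatMap fun v =>
    if TradeEdge adj n L s t (Equiv.swap s t a) (Equiv.swap s t b) a u b v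
      then unary (b * m + v) else []) ++
  unary (a * m + u))))

/-- The code of the verification instance as a nested iteration over levels and vertices. -/
noncomputable def verifyCode (adj : ℕ → ℕ → Prop) (n L m : ℕ) : List Bool :=
  unary (L * m) ++ (unary (L * m) ++ (unary (L * L) ++ (([true] ++ [false]) ++ (unary L ++
    (((List.range L).flatMap fun a => (List.range m).flatMap fun u =>
        [true] ++ unary (a * m + u)) ++
      (List.range L).flatMap fun s => (List.range L).flatMap fun t =>
        (List.range L).flatMap fun a => (List.range m).flatMap fun u =>
          prefCode adj n L m s t a u)))))

/-- Vertices from `n` on are never looked up in the graph. -/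
theorem prefCode_congr {adj adj' : ℕ → ℕ → Prop} {n : ℕ}
    (h : ∀ u < n, ∀ v < n, adj u v ↔ adj' u v) (L s t a : ℕ) {u : ℕ} (hu : u < n + 1) :
    prefCode adj n L (n + 1) s t a u = prefCode adj' n L (n + 1) s t a u := by
  have key : ∀ b, ∀ v < n + 1, ∀ p q,
      TradeEdge adj n L s t p q a u b v ↔ TradeEdge adj' n L s t p q a u b v := by
    intro b v hv p q
    have : (u = n ∨ v = n ∨ adj u v) ↔ (u = n ∨ v = n ∨ adj' u v) := by
      by_cases hun : u = n
      · simp [hun]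
      · by_cases hvn : v = n
        · simp [hvn]
        · rw [h u (by omega) v (by omega)]
    rw [TradeEdge, TradeEdge, this]
  unfold prefCode
  congr 1
  · exact flatMap_range_congr fun b _ => flatMap_range_congr fun v hv => by rw [key b v hv]
  · congr 3
    exact flatMap_range_congr fun b _ => flatMap_range_congr fun v hv => by rw [key b v hv]

theorem verifyCode_congr {adj adj' : ℕ → ℕ → Prop} {n : ℕ}
    (h : ∀ u < n, ∀ v < n, adj u v ↔ adj' u v) (L : ℕ) :
    verifyCode adj n L (n + 1) = verifyCode adj' n L (n + 1) := by
  unfold verifyCode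
  congr 6
  exact flatMap_range_congr fun s _ => flatMap_range_congr fun t _ => flatMap_range_congr fun a _ =>
    flatMap_range_congr fun u hu => prefCode_congr h L s t a hu

theorem div_mod_mul_add {m u : ℕ} (a : ℕ) (hu : u < m) :
    (a * m + u) / m = a ∧ (a * m + u) % m = u := by
  rw [Nat.mul_comm, Nat.mul_add_div (by omega), Nat.mul_add_mod, Nat.div_eq_of_lt hu,
    Nat.mod_eq_of_lt hu]
  exact ⟨rfl, rfl⟩

/-- The length of the list is written by one pass over all agents, its items by another. -/
theorem encPref_filter_append_singleton {N : ℕ} (P : ℕ → Prop) [DecidablePred P] (x : Fin N) :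
    VerifyInst.encPref ((List.finRange N).filter (fun y : Fin N => P y) ++ [x]) =
      ((List.range N).flatMap fun y => if P y then [true] else []) ++
      ([true] ++ ([false] ++
      (((List.range N).flatMap fun y => if P y then unary y else []) ++ unary x))) := by
  have h1 : ∀ l : List (Fin N), List.replicate (l.filter (fun y : Fin N => P y)).length true =
      (l.map Fin.val).flatMap fun y => if P y then [true] else [] := by
    intro l
    induction l with
    | nil => rfl
    | cons y l ih =>
      by_cases hy : P y <;> simp [hy, ← ih, List.replicate_succ]
  have h2 : ∀ l : List (Fin N),
      ((l.filter (fun y : Fin N => P y)).map fun b : Fin N => unary (b : ℕ)).flatten =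
      (l.map Fin.val).flatMap fun y => if P y then unary y else [] := by
    intro l
    induction l with
    | nil => rfl
    | cons y l ih =>
      by_cases hy : P y <;> simp [hy, ← ih]
  rw [VerifyInst.encPref, List.map_append, List.flatten_append, h2, List.length_append, unary,
    List.length_singleton, List.replicate_succ', h1, List.map_coe_finRange_eq_range]
  simp

/-- The code of the verification instance is the word that `emitVerify` writes. -/
theorem CliqueInst.toVerify_enc (J : CliqueInst) :
    J.toVerify.enc = verifyCode J.adj J.n J.levels (J.n + 1) := by
  classical
  have hp : (List.ofFn fun a => VerifyInst.encItem (J.toVerify.p a)).flatten =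
      (List.range J.levels).flatMap fun a => (List.range (J.n + 1)).flatMap fun u =>
        [true] ++ unary (a * (J.n + 1) + u) := by
    rw [← flatMap_range_mul J.levels (J.n + 1) fun x => [true] ++ unary x]
    exact flatten_ofFn_eq_flatMap_range _ fun x => unary (x + 1)
  have hl : ∀ j x, VerifyInst.encPref (J.toVerify.pref j x) =
      (fun j x : ℕ => prefCode J.adj J.n J.levels (J.n + 1) (j / J.levels) (j % J.levels)
        (x / (J.n + 1)) (x % (J.n + 1))) j x := by
    intro j x
    refine (encPref_filter_append_singleton (J.edge j x) x).trans ?_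
    simp only [prefCode]
    congr 1
    · refine (flatMap_range_mul J.levels (J.n + 1) _).trans ?_
      refine flatMap_range_congr fun b _ => flatMap_range_congr fun v hv => ?_
      rw [edge, (div_mod_mul_add b hv).1, (div_mod_mul_add b hv).2]
    · congr 3
      · refine (flatMap_range_mul J.levels (J.n + 1) _).trans ?_
        refine flatMap_range_congr fun b _ => flatMap_range_congr fun v hv => ?_
        rw [edge, (div_mod_mul_add b hv).1, (div_mod_mul_add b hv).2]
      · rw [Nat.mul_comm, Nat.div_add_mod]
  have hpref : (List.ofFn fun j => (List.ofFn fun a =>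
      VerifyInst.encPref (J.toVerify.pref j a)).flatten).flatten =
      (List.range J.levels).flatMap fun s => (List.range J.levels).flatMap fun t =>
        (List.range J.levels).flatMap fun a => (List.range (J.n + 1)).flatMap fun u =>
          prefCode J.adj J.n J.levels (J.n + 1) s t a u := by
    simp only [hl]
    have h1 : ∀ j : Fin J.toVerify.ℓ, (List.ofFn fun x : Fin J.toVerify.n =>
        prefCode J.adj J.n J.levels (J.n + 1) (j / J.levels) (j % J.levels)
          (x / (J.n + 1)) (x % (J.n + 1))).flatten = _ := fun j =>
      flatten_ofFn_eq_flatMap_range _ fun x =>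
        prefCode J.adj J.n J.levels (J.n + 1) (j / J.levels) (j % J.levels)
          (x / (J.n + 1)) (x % (J.n + 1))
    simp only [h1]
    refine (flatten_ofFn_eq_flatMap_range _ fun j => (List.range J.toVerify.n).flatMap fun x =>
        prefCode J.adj J.n J.levels (J.n + 1) (j / J.levels) (j % J.levels)
          (x / (J.n + 1)) (x % (J.n + 1))).trans ?_
    refine (flatMap_range_mul J.levels J.levels _).trans ?_
    refine flatMap_range_congr fun s _ => flatMap_range_congr fun t ht => ?_
    rw [(div_mod_mul_add s ht).1, (div_mod_mul_add s ht).2]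
    refine (flatMap_range_mul J.levels (J.n + 1) _).trans ?_
    refine flatMap_range_congr fun a _ => flatMap_range_congr fun u hu => ?_
    rw [(div_mod_mul_add a hu).1, (div_mod_mul_add a hu).2]
  rw [VerifyInst.enc, hp, hpref]
  rfl

open Classical in
/-- The code of a graph, with the adjacency matrix as a single list. -/
theorem CliqueInst.enc_eq (J : CliqueInst) : J.enc = unary J.n ++ (unary J.k ++
    (List.range (J.n * J.n)).map fun x => decide (J.adj (x / J.n) (x % J.n))) := by
  rw [CliqueInst.enc]
  congr 2
  have h1 : ∀ u : Fin J.n, (List.ofFn fun v : Fin J.n => [decide (J.G.Adj u v)]).flatten =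
      (fun u : ℕ => (List.range J.n).flatMap fun v => [decide (J.adj u v)]) u := by
    intro u
    refine Eq.trans ?_ (flatten_ofFn_eq_flatMap_range J.n fun v => [decide (J.adj u v)])
    simp only [adj_val_iff]
  simp only [h1]
  rw [flatten_ofFn_eq_flatMap_range J.n
    fun u => (List.range J.n).flatMap fun v => [decide (J.adj u v)]]
  rw [← List.flatMap_singleton' ((List.range (J.n * J.n)).map _), List.flatMap_map,
    flatMap_range_mul]
  refine flatMap_range_congr fun u _ => flatMap_range_congr fun v hv => ?_
  rw [(div_mod_mul_add u hv).1, (div_mod_mul_add u hv).2]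

/-! ### A program that writes the code of the verification instance -/

/-- Append as many ones as the value of variable `b`. -/
def emitOnes (d b : ℕ) : Prog := forLoop d b (emitBit true)

theorem Emits.ones {d b : ℕ} (hb : b < d) :
    Emits d (emitOnes d b) fun _ v => List.replicate (v b) true :=
  (Emits.forLoop hb (.bit _ true)).congr fun _ v => flatMap_range_true (v b)

/-- Append as many ones as the product of the values of the variables `b` and `b'`. -/
def emitOnesMul (d b b' : ℕ) : Prog := forLoop d b (emitOnes (d + 1) b')

theorem Emits.onesMul {d b b' : ℕ} (hb : b < d) (hb' : b' < d) :
    Emits d (emitOnesMul d b b') fun _ v => List.replicate (v b * v b') true :=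
  (Emits.forLoop hb (.ones (by omega : b' < d + 1))).congr fun _ v => by
    simp only [Function.update_of_ne hb'.ne, flatMap_range_replicate]

/-- Append the number `v a * v 2 + v u` in unary. -/
def emitPair (d a u : ℕ) : Prog :=
  .seq (emitOnesMul d a 2) (.seq (emitOnes d u) (emitBit false))

theorem Emits.pair {d a u : ℕ} (ha : a < d) (h2 : 2 < d) (hu : u < d) :
    Emits d (emitPair d a u) fun _ v => unary (v a * v 2 + v u) :=
  ((Emits.onesMul ha h2).seq ((Emits.ones hu).seq (.bit d false))).congr fun _ v => by
    rw [unary, List.replicate_add, List.append_assoc]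

/-- Set variable `d` to the image of the value of variable `a` under the transposition of the
values of the variables `s` and `t`. -/
def setSwap (d s t a : ℕ) : Prog :=
  .ite (.eq (.var a) (.var s)) (.set 4 (.lit d) (.var t))
    (.ite (.eq (.var a) (.var t)) (.set 4 (.lit d) (.var s)) (.set 4 (.lit d) (.var a)))

theorem Emits.bind_swap {d s t a : ℕ} (hs : s < d) (ht : t < d) (ha : a < d) {p : Prog}
    {o : Mem → (ℕ → ℕ) → List Bool} (hp : Emits (d + 1) p o) :
    Emits d (.seq (setSwap d s t a) p)
      fun S v => o S (Function.update v d (Equiv.swap (v s) (v t) (v a))) := by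
  refine Emits.bind (fun v => Equiv.swap (v s) (v t) (v a)) 3 (fun v B h => ?_)
    (fun S B M v h => ?_) hp
  · rw [Equiv.swap_apply_def]
    split_ifs <;> exact h _
  · have es := h.eval_var hs
    have et := h.eval_var ht
    have ea := h.eval_var ha
    have c₁ := Expr.eval_eq M (.var a) (.var s)
    have c₂ := Expr.eval_eq M (.var a) (.var t)
    rw [ea, es] at c₁
    rw [ea, et] at c₂
    rw [Equiv.swap_apply_def]
    split_ifs with h₁ h₂
    · exact ⟨2, by omega, .ite_true (c₁.2 h₁) (et ▸ .set 4 (.lit d) (.var t) M)⟩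
    · exact ⟨3, by omega, .ite_false (not_not.1 fun h => h₁ (c₁.1 h))
        (.ite_true (c₂.2 h₂) (es ▸ .set 4 (.lit d) (.var s) M))⟩
    · exact ⟨3, by omega, .ite_false (not_not.1 fun h => h₁ (c₁.1 h))
        (.ite_false (not_not.1 fun h => h₂ (c₂.1 h)) (ea ▸ .set 4 (.lit d) (.var a) M))⟩

/-- The test for a trading edge.  The variables are `n`, `L`, `n + 1`, the layer `s`, `t`, level,
vertex and position of one agent, and level, vertex and position of the other agent.  Array `6`
holds the offsets of the rows of the adjacency matrix in array `5`. -/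
def edgeTest : Expr :=
  .and
    (.and (.iff (.lt (.var 5) (.lit 2)) (.eq (.var 6) (.var 0)))
      (.iff (.lt (.var 8) (.lit 2)) (.eq (.var 9) (.var 0))))
    (.and
      (.or (.eq (.var 10) (.add (.var 7) (.lit 1)))
        (.and (.eq (.add (.var 7) (.lit 1)) (.var 1)) (.eq (.var 10) (.lit 0))))
      (.or (.not (.and (.eq (.add (.var 5) (.lit 1)) (.var 3)) (.eq (.var 8) (.var 4))))
        (.or (.eq (.var 6) (.var 0)) (.or (.eq (.var 9) (.var 0))
          (.get 5 (.add (.get 6 (.var 6)) (.var 9)))))))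

/-- The graph stored in the arrays `5` and `6`. -/
def storedAdj (S : Mem) (u v : ℕ) : Prop := S 5 (S 6 u + v) ≠ 0

theorem Represents.edgeTest {S M : Mem} {B : ℕ} {v : ℕ → ℕ} (h : Represents S B 11 M v) :
    edgeTest.eval M ≠ 0 ↔
      TradeEdge (storedAdj S) (v 0) (v 1) (v 3) (v 4) (v 7) (v 10) (v 5) (v 6) (v 8) (v 9) := by
  have hl : ∀ c, (Expr.lit c).eval M = c := fun _ => rfl
  have ha : ∀ e f : Expr, (Expr.add e f).eval M = e.eval M + f.eval M := fun _ _ => rfl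
  have hg : ∀ a i, (Expr.get a i).eval M = M a (i.eval M) := fun _ _ => rfl
  have hv : ∀ i < 11, (Expr.var i).eval M = v i := fun i hi => h.eval_var hi
  simp only [ParamCx.edgeTest, Expr.eval_and, Expr.eval_or, Expr.eval_not, Expr.eval_iff,
    Expr.eval_lt, Expr.eval_eq, hl, ha, hv _ (by decide : 0 < 11), hv _ (by decide : 1 < 11),
    hv _ (by decide : 3 < 11), hv _ (by decide : 4 < 11), hv _ (by decide : 5 < 11),
    hv _ (by decide : 6 < 11), hv _ (by decide : 7 < 11), hv _ (by decide : 8 < 11),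
    hv _ (by decide : 9 < 11), hv _ (by decide : 10 < 11), hg,
    h.static 5 (by decide) (by decide) (by decide), h.static 6 (by decide) (by decide) (by decide),
    TradeEdge, storedAdj, imp_iff_not_or]

/-- Run `p` for the agents `(b, v)` that the agent `(a, u)` prefers in the layer `(s, t)`. -/
def forEdges (p : Prog) : Prog :=
  forLoop 8 1 (forLoop 9 2 (.seq (setSwap 10 3 4 8) (.ite edgeTest p .skip)))

open Classical in
theorem Emits.edges {p : Prog} {o : Mem → (ℕ → ℕ) → List Bool} (hp : Emits 11 p o) :
    Emits 8 (forEdges p) fun S v =>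
      (List.range (v 1)).flatMap fun b => (List.range (v 2)).flatMap fun w =>
        if TradeEdge (storedAdj S) (v 0) (v 1) (v 3) (v 4) (v 7) (Equiv.swap (v 3) (v 4) b)
          (v 5) (v 6) b w
        then o S (Function.update (Function.update (Function.update v 8 b) 9 w) 10
          (Equiv.swap (v 3) (v 4) b)) else [] :=
  (Emits.forLoop (by decide) (.forLoop (by decide) (.bind_swap (by decide) (by decide) (by decide)
    (.ite _ (fun _ _ _ _ h => h.edgeTest) hp)))).congr fun _ _ => rfl

/-- Append the code of the preference list of the agent `(a, u)` in the layer `(s, t)`. -/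
def emitPref : Prog :=
  .seq (setSwap 7 3 4 5)
    (.seq (forEdges (emitBit true))
      (.seq (emitBit true) (.seq (emitBit false)
        (.seq (forEdges (emitPair 11 8 9)) (emitPair 8 5 6)))))

theorem Emits.pref : Emits 7 emitPref fun S v =>
    prefCode (storedAdj S) (v 0) (v 1) (v 2) (v 3) (v 4) (v 5) (v 6) :=
  (Emits.bind_swap (by decide) (by decide) (by decide)
    ((Emits.edges (.bit _ true)).seq ((Emits.bit _ true).seq ((Emits.bit _ false).seq
      ((Emits.edges (.pair (by decide) (by decide) (by decide))).seq
        (.pair (by decide) (by decide) (by decide))))))).congr fun _ _ => rfl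

/-- Append the code of the verification instance. -/
def emitVerify : Prog :=
  .seq (.seq (emitOnesMul 3 1 2) (emitBit false))
  (.seq (.seq (emitOnesMul 3 1 2) (emitBit false))
  (.seq (.seq (emitOnesMul 3 1 1) (emitBit false))
  (.seq (.seq (emitBit true) (emitBit false))
  (.seq (.seq (emitOnes 3 1) (emitBit false))
  (.seq (forLoop 3 1 (forLoop 4 2 (.seq (emitBit true) (emitPair 5 3 4))))
    (forLoop 3 1 (forLoop 4 1 (forLoop 5 1 (forLoop 6 2 emitPref)))))))))

theorem Emits.verify :
    Emits 3 emitVerify fun S v => verifyCode (storedAdj S) (v 0) (v 1) (v 2) := by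
  have hNM := (Emits.onesMul (by decide : 1 < 3) (by decide : 2 < 3)).seq (.bit 3 false)
  have hLL := (Emits.onesMul (by decide : 1 < 3) (by decide : 1 < 3)).seq (.bit 3 false)
  have hL := (Emits.ones (by decide : 1 < 3)).seq (.bit 3 false)
  have h1 := (Emits.bit 3 true).seq (.bit 3 false)
  have hp := Emits.forLoop (by decide : 1 < 3) (.forLoop (by decide : 2 < 4)
    ((Emits.bit 5 true).seq (.pair (by decide : 3 < 5) (by decide) (by decide : 4 < 5))))
  have hpref := Emits.forLoop (by decide : 1 < 3) (.forLoop (by decide : 1 < 4)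
    (.forLoop (by decide : 1 < 5) (.forLoop (by decide : 2 < 6) Emits.pref)))
  refine (hNM.seq (hNM.seq (hLL.seq (h1.seq (hL.seq (hp.seq hpref)))))).congr fun S v => ?_
  simp [verifyCode, unary]

/-! ### Reading the graph -/

theorem getD_unary_append {n i : ℕ} (hi : i < n) (w : List Bool) :
    (unary n ++ w).getD i false = true := by
  simp [unary, List.getD_eq_getElem?_getD, List.getElem?_append, hi]

theorem getD_unary_append_self (n : ℕ) (w : List Bool) :
    (unary n ++ w).getD n false = false := by
  simp [unary, List.getD_eq_getElem?_getD]

theorem getD_unary_append_add (n i : ℕ) (w : List Bool) :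
    (unary n ++ w).getD (n + 1 + i) false = w.getD i false := by
  rw [List.getD_append_right _ _ _ _ (by simp [unary])]
  simp [unary]

theorem CliqueInst.length_enc (J : CliqueInst) :
    J.enc.length = J.n + 1 + (J.k + 1 + J.n * J.n) := by
  simp [enc_eq, unary]
  omega

/-- The position of an entry of the adjacency matrix in the code of a graph. -/
theorem CliqueInst.getD_enc (J : CliqueInst) {u v : ℕ} (hu : u < J.n) (hv : v < J.n) :
    J.n + J.k + 2 + u * J.n + v < J.enc.length ∧
      (J.enc.getD (J.n + J.k + 2 + u * J.n + v) false = true ↔ J.adj u v) := by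
  have hlt : u * J.n + v < J.n * J.n := by
    have h := Nat.mul_le_mul_right J.n (Nat.succ_le_of_lt hu)
    rw [Nat.succ_mul] at h
    omega
  refine ⟨by rw [J.length_enc]; omega, ?_⟩
  rw [enc_eq, show J.n + J.k + 2 + u * J.n + v = J.n + 1 + (J.k + 1 + (u * J.n + v)) by omega,
    getD_unary_append_add, getD_unary_append_add]
  simp [List.getD_eq_getElem?_getD, hlt, (div_mod_mul_add u hv).1, (div_mod_mul_add u hv).2]

/-- Copy the input to array `5`. -/
def copyInput : Prog :=
  .seq (.set 4 (.lit 0) (.lit 0))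
    (.loop (.lt (.var 0) (.get 1 (.lit 0)))
      (.seq (.set 5 (.var 0) (.get 0 (.var 0))) (.set 4 (.lit 0) (.add (.var 0) (.lit 1)))))

theorem runs_copyInput (M : Mem) : ∃ M' t, Runs copyInput M M' t ∧ t ≤ M 1 0 * 3 + 2 ∧
    (∀ i < M 1 0, M' 5 i = M 0 i) ∧ M' 2 = M 2 := by
  obtain ⟨M', t, r, ht, -, h5, -, -, h2⟩ := Runs.loop_of_invariant
    (e := .lt (.var 0) (.get 1 (.lit 0)))
    (p := .seq (.set 5 (.var 0) (.get 0 (.var 0))) (.set 4 (.lit 0) (.add (.var 0) (.lit 1))))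
    (fun s M' => M' 4 0 = s ∧ (∀ i < s, M' 5 i = M 0 i) ∧ M' 0 = M 0 ∧ M' 1 = M 1 ∧ M' 2 = M 2)
    2 (M 1 0)
    (by
      rintro s hs M' ⟨h4, h5, h0, h1, h2⟩
      refine ⟨?_, _, _, .seq (.set _ _ _ _) (.set _ _ _ _), le_rfl, ?_, fun i hi => ?_, ?_, ?_, ?_⟩
      · rw [Expr.eval_lt]
        simpa [Expr.var, Expr.eval, h4, h1] using hs
      · simp [Expr.var, Expr.eval, h4, Mem.write]
      · rw [Mem.write_of_ne_array (by decide)]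
        by_cases his : i = s
        · simp [Expr.var, Expr.eval, h4, h0, his, Mem.write_self]
        · rw [Mem.write_of_ne_index (by simpa [Expr.var, Expr.eval, h4] using his), h5 i (by omega)]
      all_goals simp [Mem.write, h0, h1, h2])
    (by
      rintro M' ⟨h4, h5, h0, h1, h2⟩
      by_contra h
      rw [← ne_eq, Expr.eval_lt] at h
      simp [Expr.var, Expr.eval, h4, h1] at h)
    (M.write 4 0 0) (by simp [Mem.write])
  exact ⟨M', _, .seq (.set _ _ _ _) r, by omega, h5, h2⟩

/-- Determine the number `n` of vertices, the position of the first zero of array `5`. -/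
def countVertices : Prog :=
  .seq (.set 4 (.lit 0) (.lit 0))
    (.loop (.get 5 (.var 0)) (.set 4 (.lit 0) (.add (.var 0) (.lit 1))))

theorem runs_countVertices {M : Mem} {n : ℕ} (h : ∀ i < n, M 5 i ≠ 0) (hn : M 5 n = 0) :
    ∃ M' t, Runs countVertices M M' t ∧ t ≤ n * 2 + 2 ∧ M' 4 0 = n ∧ ∀ a, a ≠ 4 → M' a = M a := by
  obtain ⟨M', t, r, ht, h4, h'⟩ := Runs.loop_of_invariant
    (e := .get 5 (.var 0)) (p := .set 4 (.lit 0) (.add (.var 0) (.lit 1)))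
    (fun s M' => M' 4 0 = s ∧ ∀ a, a ≠ 4 → M' a = M a) 1 n
    (by
      rintro s hs M' ⟨h4, h'⟩
      refine ⟨?_, _, _, .set _ _ _ _, le_rfl, ?_, fun a ha => ?_⟩
      · simpa [Expr.var, Expr.eval, h4, h' 5 (by decide)] using h s hs
      · simp [Expr.var, Expr.eval, h4, Mem.write]
      · rw [Mem.write_of_ne_array ha, h' a ha])
    (by
      rintro M' ⟨h4, h'⟩
      simpa [Expr.var, Expr.eval, h4, h' 5 (by decide)] using hn)
    (M.write 4 0 0) ⟨by simp [Mem.write], fun a ha => Mem.write_of_ne_array ha _ _ _⟩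
  exact ⟨M', _, .seq (.set _ _ _ _) r, by omega, h4, h'⟩

/-- Set the variables `1` and `2` to the numbers of levels and of vertices, including the extra
vertex, and tabulate the offsets of the rows of the adjacency matrix in array `6`. -/
def tabulateRows : Prog :=
  .seq (.set 4 (.lit 1) (.add (.get 2 (.lit 0)) (.lit 2)))
  (.seq (.set 4 (.lit 2) (.add (.var 0) (.lit 1)))
  (.seq (.set 6 (.lit 0) (.add (.var 0) (.var 1)))
  (.seq (.set 4 (.lit 3) (.lit 0))
    (.loop (.lt (.var 3) (.var 0))
      (.seq (.set 6 (.add (.var 3) (.lit 1)) (.add (.get 6 (.var 3)) (.var 0)))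
        (.set 4 (.lit 3) (.add (.var 3) (.lit 1))))))))

theorem runs_tabulateRows {M : Mem} {n k : ℕ} (hn : M 4 0 = n) (hk : M 2 0 = k) :
    ∃ M' t, Runs tabulateRows M M' t ∧ t ≤ n * 3 + 5 ∧ M' 4 0 = n ∧ M' 4 1 = k + 2 ∧
      M' 4 2 = n + 1 ∧ M' 5 = M 5 ∧ ∀ u ≤ n, M' 6 u = n + k + 2 + u * n := by
  obtain ⟨M', t, r, ht, -, h0, h1, h2, h5, h6⟩ := Runs.loop_of_invariant
    (e := .lt (.var 3) (.var 0))
    (p := .seq (.set 6 (.add (.var 3) (.lit 1)) (.add (.get 6 (.var 3)) (.var 0)))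
        (.set 4 (.lit 3) (.add (.var 3) (.lit 1))))
    (fun s M' => M' 4 3 = s ∧ M' 4 0 = n ∧ M' 4 1 = k + 2 ∧ M' 4 2 = n + 1 ∧ M' 5 = M 5 ∧
      ∀ u ≤ s, M' 6 u = n + k + 2 + u * n) 2 n
    (by
      rintro s hs M' ⟨h3, h0, h1, h2, h5, h6⟩
      refine ⟨?_, _, _, .seq (.set _ _ _ _) (.set _ _ _ _), le_rfl, ?_, ?_, ?_, ?_, ?_,
        fun u hu => ?_⟩
      · rw [Expr.eval_lt]
        simpa [Expr.var, Expr.eval, h3, h0] using hs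
      · simp [Expr.var, Expr.eval, h3, Mem.write]
      · simp [Expr.eval, h0, Mem.write]
      · simp [Expr.eval, h1, Mem.write]
      · simp [Expr.eval, h2, Mem.write]
      · simp [h5, Mem.write]
      · rw [Mem.write_of_ne_array (by decide)]
        by_cases hus : u = s + 1
        · subst hus
          simp [Expr.var, Expr.eval, h3, h0, h6, Mem.write]
          ring
        · rw [Mem.write_of_ne_index (by simpa [Expr.var, Expr.eval, h3] using hus),
            h6 u (by omega)])
    (by
      rintro M' ⟨h3, h0, -⟩
      by_contra h
      rw [← ne_eq, Expr.eval_lt] at h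
      simp [Expr.var, Expr.eval, h3, h0] at h)
    ((((M.write 4 1 (k + 2)).write 4 2 (n + 1)).write 6 0 (n + (k + 2))).write 4 3 0)
    (by
      refine ⟨by simp [Mem.write], by simp [Mem.write, hn], by simp [Mem.write],
        by simp [Mem.write], by simp [Mem.write], fun u hu => ?_⟩
      obtain rfl : u = 0 := by omega
      simp [Mem.write]
      omega)
  refine ⟨M', 1 + (1 + (1 + (1 + t))), .seq (M₂ := M.write 4 1 (k + 2)) ?_
    (.seq (M₂ := (M.write 4 1 (k + 2)).write 4 2 (n + 1)) ?_ (.seq ?_ (.seq (.set _ _ _ _) r))),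
    by omega, h0, h1, h2, h5, h6⟩
  · exact .set_of_eq rfl (by simp [Expr.eval, hk])
  · exact .set_of_eq rfl (by simp [Expr.var, Expr.eval, Mem.write, hn])
  · exact .set_of_eq rfl (by simp [Expr.var, Expr.eval, Mem.write, hn])

/-- Read the graph and set up the arrays from which `emitVerify` works. -/
def readGraph : Prog := .seq copyInput (.seq countVertices tabulateRows)

theorem runs_readGraph (J : CliqueInst) {M : Mem} (hM : HoldsOutput M J.enc J.k) :
    ∃ M' t, Runs readGraph M M' t ∧ t ≤ 10 * (J.enc.length + 1) ∧ M' 4 0 = J.n ∧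
      M' 4 1 = J.levels ∧ M' 4 2 = J.n + 1 ∧
      ∀ u < J.n, ∀ v < J.n, storedAdj M' u v ↔ J.adj u v := by
  obtain ⟨hin, hlen, hk⟩ := hM
  obtain ⟨M₁, t₁, r₁, b₁, h5, h2⟩ := runs_copyInput M
  rw [hlen] at b₁ h5
  have hbit : ∀ i < J.enc.length, M₁ 5 i = (J.enc.getD i false).toNat := fun i hi => by
    rw [h5 i hi, hin i hi]
  have hl := J.length_enc
  obtain ⟨M₂, t₂, r₂, b₂, h0, h'⟩ := runs_countVertices (M := M₁) (n := J.n)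
    (fun i hi => by
      rw [hbit i (by omega), J.enc_eq, getD_unary_append hi]; decide)
    (by rw [hbit _ (by omega), J.enc_eq, getD_unary_append_self]; rfl)
  obtain ⟨M₃, t₃, r₃, b₃, g0, g1, g2, g5, g6⟩ := runs_tabulateRows (M := M₂) h0
    (show M₂ 2 0 = J.k by rw [h' 2 (by decide), h2, hk])
  refine ⟨M₃, t₁ + (t₂ + t₃), .seq r₁ (.seq r₂ r₃), by omega, g0, g1, g2, fun u hu v hv => ?_⟩
  obtain ⟨hlt, hadj⟩ := J.getD_enc hu hv
  rw [storedAdj, g6 u hu.le, g5, h' 5 (by decide), hbit _ hlt, ← hadj]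
  simp

/-! ### The reduction from Clique -/

/-- The values of the variables before `emitVerify`. -/
def CliqueInst.vars (J : CliqueInst) (i : ℕ) : ℕ :=
  if i = 0 then J.n else if i = 1 then J.levels else if i = 2 then J.n + 1 else 0

theorem Emits.param : Emits 3 (.seq (emitOnes 3 1) (emitOnesMul 3 1 1)) fun _ v =>
    List.replicate (v 1) true ++ List.replicate (v 1 * v 1) true :=
  (Emits.ones (by decide)).seq (.onesMul (by decide) (by decide))

/-- The program that turns the code of a graph into the code of its verification instance.  The
parameter is computed as the length of an output that is then overwritten. -/
def cliqueToVerify : Prog :=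
  .seq readGraph
  (.seq (.set 3 (.lit 0) (.lit 0))
  (.seq (.seq (emitOnes 3 1) (emitOnesMul 3 1 1))
  (.seq (.set 2 (.lit 0) (.get 3 (.lit 0)))
  (.seq (.set 3 (.lit 0) (.lit 0))
  (.seq emitVerify (.set 1 (.lit 0) (.get 3 (.lit 0))))))))

/-- The running time is bounded together with the length of the output, as in the definition of a
reduction.  Nothing is assumed about the cells of `M` that do not belong to the code of the
graph. -/
theorem runs_cliqueToVerify : ∃ C e : ℕ, ∀ (J : CliqueInst) (M : Mem), HoldsOutput M J.enc J.k →
    ∃ M' t, Runs cliqueToVerify M M' t ∧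
      t + J.toVerify.enc.length ≤ C * (J.enc.length + 1) ^ e ∧
      HoldsOutput M' J.toVerify.enc (J.levels + J.levels * J.levels) := by
  obtain ⟨c₁, e₁, h₁⟩ := Emits.param
  obtain ⟨c₂, e₂, h₂⟩ := Emits.verify
  refine ⟨14 + c₁ + c₂, 1 + e₁ + e₂, fun J M hM => ?_⟩
  obtain ⟨M₀, t₀, r₀, b₀, v0, v1, v2, hadj⟩ := runs_readGraph J hM
  have hl := J.length_enc
  set B := J.enc.length with hB
  have hrep : ∀ M', (∀ i < 3, M' 4 i = J.vars i) → Represents M' B 3 M' J.vars := by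
    refine fun M' h => ⟨h, fun _ _ _ _ => rfl, fun i => ?_⟩
    simp only [CliqueInst.vars, CliqueInst.levels]
    split_ifs <;> omega
  have hvars : ∀ i < 3, M₀ 4 i = J.vars i := by
    intro i hi
    interval_cases i <;> simp [CliqueInst.vars, v0, v1, v2]
  -- the first output has as many bits as the parameter is large
  obtain ⟨M₂, t₂, r₂, b₂, g₂, a₂⟩ := h₁ (M₀.write 3 0 0) B _ J.vars
    (hrep _ (by rwa [Mem.write_of_ne_array (by decide)]))
  have hparam : M₂ 3 0 = J.levels + J.levels * J.levels := by
    rw [a₂.length]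
    simp [Mem.write, CliqueInst.vars]
  obtain ⟨M₄, t₄, r₄, b₄, g₄, a₄⟩ := h₂ ((M₂.write 2 0 (M₂ 3 0)).write 3 0 0) B _ J.vars
    (hrep _ (by
      rw [Mem.write_of_ne_array (by decide), Mem.write_of_ne_array (by decide)]
      exact g₂.var))
  have hstatic : ∀ a, a = 5 ∨ a = 6 → (M₂.write 2 0 (M₂ 3 0)).write 3 0 0 a = M₀ a := by
    rintro a (rfl | rfl) <;>
    rw [Mem.write_of_ne_array (by decide), Mem.write_of_ne_array (by decide),
      g₂.static _ (by decide) (by decide) (by decide), Mem.write_of_ne_array (by decide)]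
  have hcode : verifyCode (storedAdj ((M₂.write 2 0 (M₂ 3 0)).write 3 0 0)) (J.vars 0) (J.vars 1)
      (J.vars 2) = J.toVerify.enc := by
    rw [J.toVerify_enc]
    refine verifyCode_congr (fun u hu v hv => ?_) J.levels
    rw [← hadj u hu v hv, storedAdj, storedAdj, hstatic 5 (Or.inl rfl), hstatic 6 (Or.inr rfl)]
  simp only [hcode] at b₄ a₄
  have hlen : M₄ 3 0 = J.toVerify.enc.length := by
    rw [a₄.length]
    simp [Mem.write]
  refine ⟨M₄.write 1 0 (M₄ 3 0), _, .seq r₀ (.seq (.set _ _ _ _) (.seq r₂ (.seq (.set _ _ _ _)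
    (.seq (.set _ _ _ _) (.seq r₄ (.set _ _ _ _)))))), ?_, fun i hi => ?_, ?_, ?_⟩
  · have k₀ : B + 1 ≤ (B + 1) ^ (1 + e₁ + e₂) := by
      calc B + 1 = (B + 1) ^ 1 := (pow_one _).symm
        _ ≤ _ := Nat.pow_le_pow_right (by omega) (by omega)
    have k₁ : (B + 1) ^ e₁ ≤ (B + 1) ^ (1 + e₁ + e₂) :=
      Nat.pow_le_pow_right (by omega) (by omega)
    have k₂ : (B + 1) ^ e₂ ≤ (B + 1) ^ (1 + e₁ + e₂) :=
      Nat.pow_le_pow_right (by omega) (by omega)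
    have := Nat.mul_le_mul_left c₁ k₁
    have := Nat.mul_le_mul_left c₂ k₂
    rw [Nat.add_mul, Nat.add_mul]
    omega
  · rw [Mem.write_of_ne_array (by decide), ← a₄.new i hi]
    simp [Mem.write]
  · rw [Mem.write_self, hlen]
  · rw [Mem.write_of_ne_array (by decide), g₄.static 2 (by decide) (by decide) (by decide),
      ← hparam]
    simp [Mem.write]

theorem primrec_polynomial (C e : ℕ) : Primrec fun x : ℕ => C * (x + 1) ^ e := by
  have h : Primrec fun x : ℕ => (x + 1) ^ e := by
    induction e with
    | zero => simpa using Primrec.const 1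
    | succ e ih => simpa only [pow_succ] using Primrec.nat_mul.comp ih Primrec.succ
  exact Primrec.nat_mul.comp (.const C) h

/-- Composing a reduction to Clique with the reduction from Clique to the complement of a
verification problem. -/
theorem Reduces.of_clique {P Q : ParamProblem} (hP : Reduces P.compl clique)
    (toQ : CliqueInst → Q.Inst) (henc : ∀ J, Q.enc (toQ J) = J.toVerify.enc)
    (hparam : ∀ J, Q.param (toQ J) = J.levels + J.levels * J.levels)
    (hyes : ∀ J, Q.Yes (toQ J) ↔ ¬ clique.Yes J) : Reduces P Q := by
  obtain ⟨prog, f, g, c, hf, hg, h⟩ := hP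
  obtain ⟨C, e, h'⟩ := runs_cliqueToVerify
  refine ⟨.seq prog cliqueToVerify, fun κ => (C + 1) * (f κ + 1) ^ (e + 1),
    fun κ => 6 * (g κ + 1) ^ 2, c * (e + 1), (primrec_polynomial _ _).to_comp.comp hf,
    (primrec_polynomial _ _).to_comp.comp hg, fun I => ?_⟩
  obtain ⟨J, M, t, hr, ht, hM, hJg, hJ⟩ : ∃ (J : CliqueInst) (M : Mem) (t : ℕ),
      Runs prog (initMem (P.enc I) (P.param I)) M t ∧
      t + J.enc.length ≤ f (P.param I) * ((P.enc I).length + 1) ^ c ∧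
      HoldsOutput M J.enc J.k ∧ J.k ≤ g (P.param I) ∧ (¬ P.Yes I ↔ clique.Yes J) := h I
  obtain ⟨M', t', hr', ht', hM'⟩ := h' J M hM
  refine ⟨toQ J, M', t + t', .seq hr hr', ?_, ?_, ?_, ?_⟩
  · rw [henc]
    have hX : 1 ≤ ((P.enc I).length + 1) ^ c := Nat.one_le_pow _ _ (by omega)
    rw [pow_mul, mul_assoc, ← mul_pow]
    generalize ((P.enc I).length + 1) ^ c = X at *
    -- `Z` bounds the length of the intermediate instance and the time of the first reduction
    have hZ : t + J.enc.length + 1 ≤ (f (P.param I) + 1) * X := by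
      rw [Nat.succ_mul]
      omega
    generalize (f (P.param I) + 1) * X = Z at *
    have h1 : (J.enc.length + 1) ^ e ≤ Z ^ (e + 1) :=
      (Nat.pow_le_pow_left (by omega) e).trans (Nat.pow_le_pow_right (by omega) (by omega))
    have h2 : Z ≤ Z ^ (e + 1) := Nat.le_self_pow (by omega) Z
    have h3 := Nat.mul_le_mul_left C h1
    rw [Nat.succ_mul]
    omega
  · rw [henc, hparam]
    exact hM'
  · rw [hparam]
    simp only [CliqueInst.levels]
    nlinarith
  · rw [hyes, ← hJ]
    exact not_not.symm

end ParamCx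

theorem mainTheorem2 :
    ParamCx.CoW1Hard ParamCx.verifyOA ∧
    ParamCx.CoW1Hard ParamCx.verifyUOA ∧
    ParamCx.CoW1Hard ParamCx.verifySOA := by
  refine ⟨fun P hP => .of_clique hP ParamCx.CliqueInst.toVerify (fun _ => rfl) (fun _ => rfl)
      fun J => ?_,
    fun P hP => .of_clique hP ParamCx.CliqueInst.toVerify (fun _ => rfl) (fun _ => rfl)
      fun J => ?_,
    fun P hP => .of_clique hP ParamCx.CliqueInst.toVerify (fun _ => rfl) (fun _ => rfl)
      fun J => ?_⟩
  · exact J.optimal_iff.trans (not_congr J.hasCommonCycle_iff)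
  · exact J.upperBoundedOptimal_iff.trans (not_congr J.hasCommonCycle_iff)
  · exact J.subsetOptimal_iff.trans (not_congr J.hasCommonCycle_iff)
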